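/- Setting. Let $K$ be a field of characteristic $0$. A formal environment consists of an associative unital $K$-algebra $\mathfrak A$, elements $Q_1,Q_2\in\mathfrak A$ with $Q_1^2=Q_2^2=-1$, $Q_1Q_2=-Q_2Q_1$, and a nilpotent two-sided ideal $I$ of $\mathfrak A$. A perturbation is a pair $(A_1,A_2)$ with $A_i-Q_i\in I$. Write $A_1=(1+a)Q_1$, $A_2=(1+b)Q_2$, and for $\varepsilon_1,\varepsilon_2=\pm1$ let $x_{\varepsilon_1\varepsilon_2}$ be the component of $x$ with $Q_ix_{\varepsilon_1\varepsilon_2}Q_i^{-1}=\varepsilon_ix_{\varepsilon_1\varepsilon_2}$. The mixed base is $$\hat r_{1}=\tfrac12(a_{+-}-b_{-+}),\ \hat r_{2}=\tfrac12(a_{+-}+b_{-+}),\ \hat r_{3}=\tfrac12(a_{++}+b_{++}),\ \hat r_{4}=\tfrac12(a_{++}-b_{++}),$$ $$\hat r_{5}=\tfrac12(a_{--}-b_{--}),\ \hat r_{6}=\tfrac12(a_{--}+b_{--}),\ \hat r_{7}=\tfrac12(a_{-+}+b_{+-}),\ \hat r_{8}=\tfrac12(a_{-+}-b_{+-}).$$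 A formal FQ operation $\Xi$ is a scalar ($s=0$), vectorial ($s\in\{1,2\}$) or pseudoscalar ($s=12$) operation given by arbitrary coefficients $\hat p^{[s]}_{\iota_1,\ldots,\iota_r}\in K$ ($r\ge0$, $\iota_j\in\{1,\ldots,8\}$); its value on a perturbation has the components $$\Xi^{[s]}(A_1,A_2)=\Big(\sum_{r\ge 0}\ \sum_{\iota_1,\ldots,\iota_r}\hat p^{[s]}_{\iota_1,\ldots,\iota_r}\hat r_{\iota_1}\cdots\hat r_{\iota_r}\Big)Q_{[s]},\qquad Q_{[0]}=1,\ Q_{[1]}=Q_1,\ Q_{[2]}=Q_2,\ Q_{[12]}=Q_1Q_2 .$$ $\Xi$ is conjugation-invariant if $\Xi(gA_1g^{-1},gA_2g^{-1})=g\,\Xi(A_1,A_2)\,g^{-1}$ in all environments, for all perturbations and all units $g\in1+I$; it is conjugation-invariant on a class of perturbations if this holds whenever $(A_1,A_2)$ and $(gA_1g^{-1},gA_2g^{-1})$ are both in the class. With binomial series, put $\mathrm{pol}\,X=X(-X^2)^{-1/2}$, $\mathcal A_L=\mathrm{pol}(-A_1A_2^{-1})$, $\mathcal A_R=\mathrm{pol}(A_2^{-1}A_1)$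 and $\mathcal B=\mathcal B(A_1,A_2)=(-\mathcal A_L\mathcal A_R)^{1/2}$. The pair is monoaxial if $\mathcal A_L=\mathcal A_R$; this element is then its axis. $\Xi$ is an axial extension if there is a formal FQ operation $\Psi$ of the same kind, conjugation-invariant on monoaxial pairs, such that in all environments and for all perturbations $$\Xi(A_1,A_2)=\Psi^{\mathrm x}(A_1,A_2):=\Psi(A_1\mathcal B^{-1},A_2\mathcal B^{-1})\cdot\mathcal B .$$ For $S\subseteq\{1,\ldots,8\}$ let $S^*$ be the set of finite words (including the empty one) in $S$. A reduction scheme to $S$ is a family of constants $c^{[s]}_{w,v}\in K$ ($s\in\{0,1,2,12\}$, $w\in\{1,\ldots,8\}^*$, $v\in S^*$) such that $c^{[s]}_{w,v}=0$ if $v$ is longer than $w$, and $c^{[s]}_{w,v}=\delta_{w,v}$ if $w\in S^*$. The operation $\Xi$ obeys the scheme on a set $W$ of words if $\hat p^{[s]}_w=\sum_{v\in S^*}c^{[s]}_{w,v}\,\hat p^{[s]}_v$ for all components $s$ of $\Xi$ and all $w\in W$. Theorem. (1) The lower indices $1,2,7,8$ can be eliminated: there is a reduction scheme $c$ to $\{3,4,5,6\}$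 such that a formal FQ operation $\Xi$ (of any kind) is an axial extension if and only if it obeys $c$ on all words and is conjugation-invariant on the monoaxial pairs with axis $Q_1Q_2$. (2) Taking conjugation-invariance into account, the lower indices are reduced to $3,4,5$: there is a reduction scheme $d$ to $\{3,4,5\}$ such that for every formal FQ operation $\Xi$ the following are equivalent: (a) $\Xi$ is an axial extension; (b) $\Xi$ is conjugation-invariant and obeys $d$ on all words in $\{1,2,3,4,5\}^*$ (that is, in addition to conjugation-invariance, the indices $1,2$ are eliminated); (c) $\Xi$ obeys $d$ on all words (so that the coefficients with lower indices in $\{3,4,5\}$ can be prescribed arbitrarily and determine $\Xi$). -/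

import Mathlib

universe u

noncomputable section

namespace FQ

/-! ### Formal environments: perturbations of a Clifford system -/

/-- A formal environment with a base Clifford system in the `K`-algebra `𝔄`:
elements `Q₁, Q₂` with `Q₁² = Q₂² = -1`, `Q₁ Q₂ = - Q₂ Q₁`, and a nilpotent two-sided ideal `I`
of infinitesimal elements. Identities between formal (noncommutative) power series without convergence
are exactly the identities that hold in all such environments. -/
structure Env (K : Type u) (𝔄 : Type u) [Field K] [Ring 𝔄] [Algebra K 𝔄] where
  Q₁ : 𝔄
  Q₂ : 𝔄
  sq₁ : Q₁ * Q₁ = -1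
  sq₂ : Q₂ * Q₂ = -1
  anticomm : Q₁ * Q₂ = -(Q₂ * Q₁)
  I : Submodule K 𝔄
  mul_mem_left : ∀ a x : 𝔄, x ∈ I → a * x ∈ I
  mul_mem_right : ∀ a x : 𝔄, x ∈ I → x * a ∈ I
  nilpotent : ∃ N : ℕ, I ^ N = ⊥

/-- `x^{-1/2}`, by the binomial series `∑ (-1)ⁿ 4⁻ⁿ (2n choose n) (x - 1)ⁿ`; the sum is finite
when `x - 1` is nilpotent, which is the only case in which it is used. -/
def invSqrt (K : Type u) {𝔄 : Type u} [Field K] [Ring 𝔄] [Algebra K 𝔄] (x : 𝔄) : 𝔄 :=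
  ∑ᶠ n : ℕ, ((-1) ^ n * (Nat.centralBinom n : K) / 4 ^ n) • (x - 1) ^ n

/-- `x^{1/2} = x · x^{-1/2}`. -/
def sqrt (K : Type u) {𝔄 : Type u} [Field K] [Ring 𝔄] [Algebra K 𝔄] (x : 𝔄) : 𝔄 :=
  x * invSqrt K x

/-- `pol X = X (-X²)^{-1/2}`. -/
def pol (K : Type u) {𝔄 : Type u} [Field K] [Ring 𝔄] [Algebra K 𝔄] (X : 𝔄) : 𝔄 :=
  X * invSqrt K (-(X * X))

/-- The left axis `𝒜_L(A₁, A₂) = pol (-A₁ A₂⁻¹)`. -/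
def axisL (K : Type u) {𝔄 : Type u} [Field K] [Ring 𝔄] [Algebra K 𝔄] (A₁ A₂ : 𝔄) : 𝔄 :=
  pol K (-(A₁ * Ring.inverse A₂))

/-- The right axis `𝒜_R(A₁, A₂) = pol (A₂⁻¹ A₁)`. -/
def axisR (K : Type u) {𝔄 : Type u} [Field K] [Ring 𝔄] [Algebra K 𝔄] (A₁ A₂ : 𝔄) : 𝔄 :=
  pol K (Ring.inverse A₂ * A₁)

/-- The biaxiality `ℬ(A₁, A₂) = (-𝒜_L(A₁, A₂) · 𝒜_R(A₁, A₂))^{1/2}`. -/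
def biax (K : Type u) {𝔄 : Type u} [Field K] [Ring 𝔄] [Algebra K 𝔄] (A₁ A₂ : 𝔄) : 𝔄 :=
  sqrt K (-(axisL K A₁ A₂ * axisR K A₁ A₂))

/-- The lower indices `1, …, 8` of the mixed base. -/
inductive MixedIndex
  | i1 | i2 | i3 | i4 | i5 | i6 | i7 | i8

/-- The upper indices `[0], [1], [2], [12]`. -/
inductive Comp
  | c0 | c1 | c2 | c12

section Env

variable {K : Type u} {𝔄 : Type u} [Field K] [Ring 𝔄] [Algebra K 𝔄]

/-- `(A₁, A₂)` is a formal perturbation of `(Q₁, Q₂)`. -/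
def Env.IsPert (E : Env K 𝔄) (A₁ A₂ : 𝔄) : Prop :=
  A₁ - E.Q₁ ∈ E.I ∧ A₂ - E.Q₂ ∈ E.I

/-- The component of `x` on which conjugation by `Q₁` acts as the sign `ε₁` and
conjugation by `Q₂` as the sign `ε₂` (recall that `Q_i⁻¹ = -Q_i`). -/
def Env.part (E : Env K 𝔄) (ε₁ ε₂ : ℤˣ) (x : 𝔄) : 𝔄 :=
  (4⁻¹ : K) • (x - (ε₁ : ℤ) • (E.Q₁ * x * E.Q₁) - (ε₂ : ℤ) • (E.Q₂ * x * E.Q₂)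
    - ((ε₁ * ε₂ : ℤˣ) : ℤ) • (E.Q₁ * E.Q₂ * x * (E.Q₁ * E.Q₂)))

/-- The components `r̂₁, …, r̂₈` of a perturbation in the mixed base. With
`A₁ = (1 + a) Q₁` and `A₂ = (1 + b) Q₂`, one has
`a = r̂₁ + r̂₂ + r̂₃ + r̂₄ + r̂₅ + r̂₆ + r̂₇ + r̂₈` and
`b = -r̂₁ + r̂₂ + r̂₃ - r̂₄ - r̂₅ + r̂₆ + r̂₇ - r̂₈`. -/
def Env.r (E : Env K 𝔄) (A₁ A₂ : 𝔄) : MixedIndex → 𝔄 :=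
  let a : 𝔄 := -(A₁ * E.Q₁) - 1
  let b : 𝔄 := -(A₂ * E.Q₂) - 1
  fun
  | .i1 => (2⁻¹ : K) • (E.part 1 (-1) a - E.part (-1) 1 b)
  | .i2 => (2⁻¹ : K) • (E.part 1 (-1) a + E.part (-1) 1 b)
  | .i3 => (2⁻¹ : K) • (E.part 1 1 a + E.part 1 1 b)
  | .i4 => (2⁻¹ : K) • (E.part 1 1 a - E.part 1 1 b)
  | .i5 => (2⁻¹ : K) • (E.part (-1) (-1) a - E.part (-1) (-1) b)
  | .i6 => (2⁻¹ : K) • (E.part (-1) (-1) a + E.part (-1) (-1) b)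
  | .i7 => (2⁻¹ : K) • (E.part (-1) 1 a + E.part 1 (-1) b)
  | .i8 => (2⁻¹ : K) • (E.part (-1) 1 a - E.part 1 (-1) b)

/-- `Q_{[0]} = 1`, `Q_{[1]} = Q₁`, `Q_{[2]} = Q₂`, `Q_{[12]} = Q₁ Q₂`. -/
def Env.Qc (E : Env K 𝔄) : Comp → 𝔄
  | .c0 => 1
  | .c1 => E.Q₁
  | .c2 => E.Q₂
  | .c12 => E.Q₁ * E.Q₂

/-- `(A₁, A₂)` is monoaxial: its left and right axes agree. -/
def Env.IsMonoaxial (_E : Env K 𝔄) (A₁ A₂ : 𝔄) : Prop :=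
  axisL K A₁ A₂ = axisR K A₁ A₂

/-- `(A₁, A₂)` is monoaxial, and its axis is the axis `Q₁ Q₂` of the base. -/
def Env.IsBaseAxial (E : Env K 𝔄) (A₁ A₂ : 𝔄) : Prop :=
  axisL K A₁ A₂ = E.Q₁ * E.Q₂ ∧ axisR K A₁ A₂ = E.Q₁ * E.Q₂

end Env

/-! ### Formal FQ operations -/

/-- Scalar, vectorial and pseudoscalar operations. -/
inductive Kind
  | scalar | vectorial | pseudoscalar

/-- The components of an operation of the given kind. -/
def Kind.comps : Kind → Set Comp
  | .scalar => {.c0}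
  | .vectorial => {.c1, .c2}
  | .pseudoscalar => {.c12}

/-- A formal (sign-linear) FQ operation in two variables, given by its
coefficients `p̂^{[s]}_{ι₁,…,ι_r}` in the mixed base. -/
structure Operation (K : Type u) (τ : Kind) where
  coeff : τ.comps → List MixedIndex → K

namespace Operation

variable {K : Type u} [Field K] {τ : Kind}

/-- The component `[s]` of the value of the operation on a perturbation `(A₁, A₂)` of `(Q₁, Q₂)`:
`(∑ p̂^{[s]}_{ι₁,…,ι_r} r̂_{ι₁} ⋯ r̂_{ι_r}) Q_{[s]}`.
For a perturbation only finitely many terms are nonzero. -/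
def eval (Ξ : Operation K τ) {𝔄 : Type u} [Ring 𝔄] [Algebra K 𝔄] (E : Env K 𝔄)
    (A₁ A₂ : 𝔄) (s : τ.comps) : 𝔄 :=
  (∑ᶠ w : List MixedIndex, Ξ.coeff s w • (w.map (E.r A₁ A₂)).prod) * E.Qc s

/-- Conjugation-invariance of the operation on the perturbations that satisfy `P`: if `P` holds for both
`(A₁, A₂)` and `(g A₁ g⁻¹, g A₂ g⁻¹)`, then `Ξ(g A₁ g⁻¹, g A₂ g⁻¹) = g Ξ(A₁, A₂) g⁻¹`. Here `g`
is infinitesimally close to `1`, so that both pairs are perturbations of the same base. -/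
def IsConjInvariantOn (Ξ : Operation K τ)
    (P : ∀ {𝔄 : Type u} [Ring 𝔄] [Algebra K 𝔄], Env K 𝔄 → 𝔄 → 𝔄 → Prop) : Prop :=
  ∀ (𝔄 : Type u) [Ring 𝔄] [Algebra K 𝔄] (E : Env K 𝔄) (A₁ A₂ : 𝔄) (g : 𝔄ˣ),
    E.IsPert A₁ A₂ → (g : 𝔄) - 1 ∈ E.I →
    P E A₁ A₂ → P E (g * A₁ * (g⁻¹ : 𝔄ˣ)) (g * A₂ * (g⁻¹ : 𝔄ˣ)) →
    ∀ s : τ.comps,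
      Ξ.eval E (g * A₁ * (g⁻¹ : 𝔄ˣ)) (g * A₂ * (g⁻¹ : 𝔄ˣ)) s
        = g * Ξ.eval E A₁ A₂ s * (g⁻¹ : 𝔄ˣ)

/-- Conjugation-invariance. -/
def IsConjInvariant (Ξ : Operation K τ) : Prop :=
  Ξ.IsConjInvariantOn (fun _ _ _ => True)

/-- `Ξ` is the axial extension `Ψ^x` of `Ψ`:
`Ξ(A₁, A₂) = Ψ(A₁ ℬ⁻¹, A₂ ℬ⁻¹) · ℬ` with `ℬ = ℬ(A₁, A₂)`. -/
def IsAxialExtensionOf (Ξ Ψ : Operation K τ) : Prop :=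
  ∀ (𝔄 : Type u) [Ring 𝔄] [Algebra K 𝔄] (E : Env K 𝔄) (A₁ A₂ : 𝔄),
    E.IsPert A₁ A₂ → ∀ s : τ.comps,
      Ξ.eval E A₁ A₂ s
        = Ψ.eval E (A₁ * Ring.inverse (biax K A₁ A₂)) (A₂ * Ring.inverse (biax K A₁ A₂)) s
            * biax K A₁ A₂

/-- `Ξ` is an axial extension: `Ξ = Ψ^x` for some operation `Ψ` that is conjugation-invariant
on monoaxial pairs (the pairs to which `Ψ` is applied are monoaxial, so its other values play no role). -/
def IsAxialExtension (Ξ : Operation K τ) : Prop :=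
  ∃ Ψ : Operation K τ, Ψ.IsConjInvariantOn Env.IsMonoaxial ∧ Ξ.IsAxialExtensionOf Ψ

end Operation

/-! ### Elimination of lower indices -/

/-- The words (finite sequences of lower indices) with all letters in `S`. -/
def words (S : Set MixedIndex) : Set (List MixedIndex) :=
  {w | ∀ i ∈ w, i ∈ S}

/-- `c` is a scheme of linear rules that reduces the lower indices to those in `S`: the right side of the
rule for the word `w` in component `[s]` is a linear combination of words with letters in `S`, not longer
than `w`, and the rule for a word with letters in `S` is the trivial one. -/
def IsReduction {K : Type u} [Field K] (S : Set MixedIndex)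
    (c : Comp → List MixedIndex → (List MixedIndex →₀ K)) : Prop :=
  (∀ s w, ∀ v ∈ (c s w).support, v ∈ words S ∧ v.length ≤ w.length) ∧
  (∀ s, ∀ w ∈ words S, c s w = Finsupp.single w 1)

/-- The coefficients of `Ξ` obey the rules `p̂^{[s]}_w = ∑_v c^{[s]}_{w,v} p̂^{[s]}_v` of the scheme `c`
for all words `w` with letters in `T`. -/
def Operation.Obeys {K : Type u} [Field K] {τ : Kind} (Ξ : Operation K τ) (T : Set MixedIndex)
    (c : Comp → List MixedIndex → (List MixedIndex →₀ K)) : Prop :=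
  ∀ s : τ.comps, ∀ w ∈ words T, Ξ.coeff s w = (c s w).sum fun v a => a * Ξ.coeff s v

end FQ

end

noncomputable section

namespace FQ

/-! Every perturbation has a normal form in which only the components 3, 4, 5 survive
(`exists_normalizer`). Dividing by ℬ makes the pair monoaxial, because ℬ conjugates the right axis
to the left one (`IsPert.conj_axisR`). A rotation then carries the common axis to J = Q₁Q₂, which
means that the components 1, 2, 7, 8 vanish. A second rotation, commuting with J, carries the
polarized average of A₁ and A₂J to Q₁, which kills component 6. A conjugation between two normal
forms of the same pair commutes with Q₁ and Q₂ (`IsPert.commute_of_isNormal`). A word in the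
components of the normal form, conjugated back and multiplied by ℬ, therefore depends on the pair
alone.

Such a pulled-back word is a noncommutative power series in the original components, with
coefficients `expCoeff` that are the same in all environments (`exists_expansion`). They are found
in a universal environment of each order of nilpotency. Their independence of the order comes from
an environment in which words up to a given length are linearly independent
(`exists_separating_env`). The transpose of this coefficient matrix, restricted to words in 3, 4, 5,
is the scheme `reduction`.

An axial extension is the pullback of its values on normal forms, so it obeys `reduction`.
Conversely, an operation obeying it is given by that pullback, which shows both
conjugation-invariance and axiality. This is the equivalence of (a) and (c).

The other characterizations compare Ξ with the operation `reduce Ξ`, which has the same coefficients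
on words in 3, 4, 5. Invariance on pairs with axis J forces agreement on words in 3, 4, 5, 6. Full
invariance reduces the comparison to words in 1, …, 5, since conjugation alone removes the
components 6, 7, 8 by successive approximation (`IsPert.exists_conj_r_eq_zero`). -/

/-- The power series `(1 + X)^{-1/2}`. -/
def invSqrtSeries (K : Type u) [Field K] : PowerSeries K :=
  PowerSeries.mk fun n => (-1) ^ n * (Nat.centralBinom n : K) / 4 ^ n

/-! ### The binomial series and its truncations -/

section Series

variable {K : Type u} [Field K] [CharZero K]

/-- Coefficientwise, this is the recursion (n + 1) C(n + 1) = 2 (2n + 1) C(n) for the central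
binomial coefficients C(n). -/
theorem one_add_X_mul_derivative_invSqrtSeries :
    2 * ((1 + PowerSeries.X) * PowerSeries.derivative K (invSqrtSeries K)) = -invSqrtSeries K := by
  have h4 : (4 : K) ≠ 0 := by norm_num
  ext n
  have key : ∀ n : ℕ, ((n : K) + 1) * (Nat.centralBinom (n + 1) : K)
      = 2 * (2 * n + 1) * Nat.centralBinom n := fun n => by
    exact_mod_cast Nat.succ_mul_centralBinom_succ n
  rw [show (2 : PowerSeries K) = PowerSeries.C (2 : K) by rw [map_ofNat], PowerSeries.coeff_C_mul, add_mul,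
    one_mul, map_add]
  rcases n with _ | n
  · have := key 0
    simp [invSqrtSeries, PowerSeries.coeff_derivative] at this ⊢
    rw [this]; norm_num
  · rw [PowerSeries.coeff_succ_X_mul]
    simp only [invSqrtSeries, PowerSeries.coeff_derivative, PowerSeries.coeff_mk, map_neg]
    have := key (n + 1)
    push_cast at this ⊢
    field_simp
    ring_nf at this ⊢
    linear_combination (8 * (-1) ^ n * 4 ^ n) * this

/-- By the differential equation the derivative of the left side vanishes, and in characteristic 0
the constant term decides. -/
theorem invSqrtSeries_sq_mul : invSqrtSeries K ^ 2 * (1 + PowerSeries.X) = 1 := by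
  apply PowerSeries.derivative.ext
  · have h := one_add_X_mul_derivative_invSqrtSeries (K := K)
    simp [Derivation.leibniz_pow, Derivation.leibniz]
    linear_combination invSqrtSeries K * h
  · simp [invSqrtSeries]

/-- Polynomial form of the previous identity, which can be evaluated at an element with vanishing
N-th power. -/
theorem X_pow_dvd_trunc_invSqrtSeries (N : ℕ) :
    (Polynomial.X : Polynomial K) ^ N ∣
      (PowerSeries.trunc N (invSqrtSeries K)) ^ 2 * (1 + Polynomial.X) - 1 := by
  set p := PowerSeries.trunc N (invSqrtSeries K) with hp
  have h1 : (PowerSeries.X : PowerSeries K) ^ N ∣ (p : PowerSeries K) - invSqrtSeries K := by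
    rw [PowerSeries.X_pow_dvd_iff]
    intro m hm
    simp [hp, PowerSeries.coeff_trunc, hm]
  have h2 : (PowerSeries.X : PowerSeries K) ^ N ∣
      ((p ^ 2 * (1 + Polynomial.X) - 1 : Polynomial K) : PowerSeries K) := by
    have : ((p ^ 2 * (1 + Polynomial.X) - 1 : Polynomial K) : PowerSeries K)
        = ((p : PowerSeries K) - invSqrtSeries K)
          * (((p : PowerSeries K) + invSqrtSeries K) * (1 + PowerSeries.X)) := by
      push_cast
      linear_combination invSqrtSeries_sq_mul (K := K)
    rw [this]
    exact Dvd.dvd.mul_right h1 _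
  rw [PowerSeries.X_pow_dvd_iff] at h2
  rw [Polynomial.X_pow_dvd_iff]
  intro d hd
  rw [← Polynomial.coeff_coe]
  exact h2 d hd

end Series

/-! ### Inverse square roots of unipotent elements -/

section InvSqrt

variable {K : Type u} {𝔄 : Type u} [Field K] [Ring 𝔄] [Algebra K 𝔄]

theorem invSqrt_eq_sum {x : 𝔄} {N : ℕ} (h : (x - 1) ^ N = 0) :
    invSqrt K x = ∑ n ∈ Finset.range N,
      ((-1) ^ n * (Nat.centralBinom n : K) / 4 ^ n) • (x - 1) ^ n := by
  apply finsum_eq_sum_of_support_subset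
  intro n hn
  by_contra hN
  simp only [Finset.coe_range, Set.mem_Iio, not_lt] at hN
  exact hn (by simp [pow_eq_zero_of_le hN h])

theorem invSqrt_eq_aeval {x : 𝔄} {N : ℕ} (h : (x - 1) ^ N = 0) :
    invSqrt K x = Polynomial.aeval (x - 1) (PowerSeries.trunc N (invSqrtSeries K)) := by
  have ht : PowerSeries.trunc N (invSqrtSeries K) = ∑ n ∈ Finset.range N,
      Polynomial.monomial n ((-1) ^ n * (Nat.centralBinom n : K) / 4 ^ n) := by
    ext m
    simp [PowerSeries.coeff_trunc, Polynomial.finsetSum_coeff, Polynomial.coeff_monomial,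
      invSqrtSeries]
  rw [invSqrt_eq_sum h, ht, map_sum]
  refine Finset.sum_congr rfl fun n _ => ?_
  simp [Polynomial.aeval_monomial, Algebra.smul_def]

theorem invSqrt_sq_mul [CharZero K] {x : 𝔄} (h : IsNilpotent (x - 1)) :
    invSqrt K x * invSqrt K x * x = 1 := by
  obtain ⟨N, hN⟩ := h
  obtain ⟨q, hq⟩ := X_pow_dvd_trunc_invSqrtSeries (K := K) N
  have := congrArg (Polynomial.aeval (x - 1)) hq
  simp [hN, pow_two, ← invSqrt_eq_aeval hN] at this
  exact sub_eq_zero.mp this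

theorem invSqrt_one : invSqrt K (1 : 𝔄) = 1 := by
  rw [invSqrt_eq_sum (N := 1) (by simp)]
  simp

theorem map_invSqrt {𝔅 : Type u} [Ring 𝔅] [Algebra K 𝔅] (φ : 𝔄 →ₐ[K] 𝔅) {x : 𝔄}
    (h : IsNilpotent (x - 1)) : φ (invSqrt K x) = invSqrt K (φ x) := by
  obtain ⟨N, hN⟩ := h
  have hN' : (φ x - 1) ^ N = 0 := by rw [← map_one φ, ← map_sub, ← map_pow, hN, map_zero]
  rw [invSqrt_eq_sum hN, invSqrt_eq_sum hN']
  simp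

theorem invSqrt_mem {x : 𝔄} (R : Subalgebra K 𝔄) (hx : x ∈ R) (h : IsNilpotent (x - 1)) :
    invSqrt K x ∈ R := by
  obtain ⟨N, hN⟩ := h
  rw [invSqrt_eq_sum hN]
  exact sum_mem fun n _ => R.smul_mem (pow_mem (sub_mem hx (one_mem R)) n) _

theorem commute_invSqrt {x y : 𝔄} (hxy : Commute y x) (h : IsNilpotent (x - 1)) :
    Commute y (invSqrt K x) := by
  obtain ⟨N, hN⟩ := h
  rw [invSqrt_eq_sum hN]
  refine Commute.sum_right _ _ _ fun n _ => ?_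
  exact ((hxy.sub_right (Commute.one_right y)).pow_right n).smul_right _

end InvSqrt

namespace Env

variable {K : Type u} {𝔄 : Type u} [Field K] [Ring 𝔄] [Algebra K 𝔄] (E : Env K 𝔄)

/-! ### Congruence modulo the nilpotent ideal -/

/-- Congruence modulo the ideal of infinitesimals. -/
def Cong (x y : 𝔄) : Prop := x - y ∈ E.I

variable {E} {x y z x' y' : 𝔄}

theorem Cong.refl (x : 𝔄) : E.Cong x x := by simp [Cong]

theorem Cong.symm (h : E.Cong x y) : E.Cong y x := by
  simpa [Cong] using neg_mem h

theorem Cong.trans (h : E.Cong x y) (h' : E.Cong y z) : E.Cong x z := by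
  simpa [Cong] using add_mem h h'

theorem Cong.add (h : E.Cong x y) (h' : E.Cong x' y') : E.Cong (x + x') (y + y') := by
  have := add_mem h h'
  rwa [show x - y + (x' - y') = x + x' - (y + y') by abel] at this

theorem Cong.neg (h : E.Cong x y) : E.Cong (-x) (-y) := by
  have := neg_mem h
  rwa [show -(x - y) = -x - -y by abel] at this

theorem Cong.sub (h : E.Cong x y) (h' : E.Cong x' y') : E.Cong (x - x') (y - y') := by
  simpa [sub_eq_add_neg] using h.add h'.neg

theorem Cong.smul (c : K) (h : E.Cong x y) : E.Cong (c • x) (c • y) := by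
  have := E.I.smul_mem c h
  rwa [smul_sub] at this

theorem Cong.mul (h : E.Cong x y) (h' : E.Cong x' y') : E.Cong (x * x') (y * y') := by
  have := add_mem (E.mul_mem_right x' _ h) (E.mul_mem_left y _ h')
  rwa [show (x - y) * x' + y * (x' - y') = x * x' - y * y' by noncomm_ring] at this

theorem Cong.mem (h : E.Cong x y) : x - y ∈ E.I := h

theorem isNilpotent_of_mem (h : x ∈ E.I) : IsNilpotent x := by
  obtain ⟨N, hN⟩ := E.nilpotent
  refine ⟨N, ?_⟩
  have := Submodule.pow_mem_pow E.I h N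
  simpa [hN] using this

theorem Cong.isNilpotent (h : E.Cong x y) : IsNilpotent (x - y) := isNilpotent_of_mem h

theorem Cong.isUnit (h : E.Cong x 1) : IsUnit x := by
  have := h.isNilpotent.isUnit_add_one
  simpa using this

theorem mul_mem_pow_left {n : ℕ} (hn : n ≠ 0) (a : 𝔄) (h : x ∈ E.I ^ n) : a * x ∈ E.I ^ n := by
  obtain ⟨n, rfl⟩ := Nat.exists_eq_succ_of_ne_zero hn
  rw [Nat.succ_eq_add_one, pow_succ'] at h ⊢
  induction h using Submodule.mul_induction_on' with
  | mem_mul_mem p hp q hq =>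
    rw [← mul_assoc]
    exact Submodule.mul_mem_mul (E.mul_mem_left a p hp) hq
  | add p _ q _ hp hq => rw [mul_add]; exact add_mem hp hq

theorem mul_mem_pow_right {n : ℕ} (hn : n ≠ 0) (a : 𝔄) (h : x ∈ E.I ^ n) : x * a ∈ E.I ^ n := by
  obtain ⟨n, rfl⟩ := Nat.exists_eq_succ_of_ne_zero hn
  rw [Nat.succ_eq_add_one, pow_succ] at h ⊢
  induction h using Submodule.mul_induction_on' with
  | mem_mul_mem p hp q hq =>
    rw [mul_assoc]
    exact Submodule.mul_mem_mul hp (E.mul_mem_right a q hq)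
  | add p _ q _ hp hq => rw [add_mul]; exact add_mem hp hq

theorem pow_eq_bot_of_le {N n : ℕ} (hN : E.I ^ N = ⊥) (h : N ≤ n) : E.I ^ n = ⊥ := by
  obtain ⟨k, rfl⟩ := Nat.exists_eq_add_of_le h
  rw [pow_add, hN, Submodule.bot_mul]

theorem eq_zero_of_forall_mem_pow (h : ∀ n, x ∈ E.I ^ (n + 1)) : x = 0 := by
  obtain ⟨N, hN⟩ := E.nilpotent
  simpa [pow_eq_bot_of_le hN (Nat.le_succ N)] using h N

/-- The equation moves d from each power of the ideal to the next one. This is the common source of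
the uniqueness statements about square roots and axes. -/
theorem eq_zero_of_two_smul_eq [CharZero K] {p q d : 𝔄} (hp : p ∈ E.I) (hq : q ∈ E.I)
    (h : (2 : K) • d = p * d + d * q) : d = 0 := by
  have hd : d = (2⁻¹ : K) • (p * d + d * q) := by
    rw [← h, smul_smul]; simp
  refine eq_zero_of_forall_mem_pow (E := E) fun n => ?_
  induction n with
  | zero =>
    rw [hd, zero_add, pow_one]
    exact E.I.smul_mem _ (add_mem (E.mul_mem_right _ _ hp) (E.mul_mem_left _ _ hq))
  | succ n ih =>
    rw [hd]
    refine Submodule.smul_mem _ _ (add_mem ?_ ?_)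
    · rw [pow_succ']; exact Submodule.mul_mem_mul hp ih
    · rw [pow_succ]; exact Submodule.mul_mem_mul ih hq

/-! ### Square roots of `-1` -/

theorem eq_of_mul_self_eq_neg_one [CharZero K] {P Z : 𝔄} (hP : P * P = -1) (hZ : Z * Z = -1)
    (hc : Commute P Z) (h : E.Cong P Z) : P = Z := by
  rw [← sub_eq_zero]
  -- With d = P - Z, commutativity gives 2d = d(dZ), and dZ is infinitesimal.
  refine eq_zero_of_two_smul_eq (K := K) (E := E) (p := 0) (q := (P - Z) * Z) (zero_mem _)
    (E.mul_mem_right _ _ h) ?_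
  have h1 : (P - Z) * ((P - Z) * Z) = P * P * Z - P * (Z * Z) - Z * P * Z + Z * Z * Z := by
    noncomm_ring
  rw [h1, ← hc.eq, mul_assoc P Z Z, hP, hZ, two_smul]
  noncomm_ring

/-- The element that rotates `P` to `Z`, if `P² = Z² = -1` and `P`, `Z` are congruent. -/
theorem exists_rotation [CharZero K] {P Z : 𝔄} (hP : P * P = -1) (hZ : Z * Z = -1)
    (h : E.Cong P Z) : ∃ g : 𝔄ˣ, (g : 𝔄) = (2⁻¹ : K) • (1 - Z * P) ∧ E.Cong g 1 ∧
      g * P * (g⁻¹ : 𝔄ˣ) = Z := by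
  have hg : E.Cong ((2⁻¹ : K) • (1 - Z * P)) 1 := by
    have := ((Cong.refl (E := E) 1).sub ((Cong.refl Z).mul h)).smul (2⁻¹ : K)
    rwa [hZ, show (2⁻¹ : K) • ((1 : 𝔄) - -1) = 1 by
      rw [sub_neg_eq_add, ← two_smul K (1 : 𝔄), smul_smul]; simp] at this
  obtain ⟨g, hg'⟩ := hg.isUnit
  refine ⟨g, hg', by rwa [hg'], ?_⟩
  -- Both gP and Zg equal (P + Z)/2.
  rw [Units.mul_inv_eq_iff_eq_mul, hg', smul_mul_assoc, mul_smul_comm, sub_mul, mul_sub, mul_assoc,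
    hP, ← mul_assoc, hZ]
  congr 1
  noncomm_ring

theorem invSqrt_cong [CharZero K] {w : 𝔄} (h : E.Cong w 1) : E.Cong (invSqrt K w) 1 := by
  obtain ⟨N, hN⟩ := h.isNilpotent
  rw [invSqrt_eq_sum (pow_eq_zero_of_le (Nat.le_succ N) hN), Finset.sum_range_succ']
  have : E.Cong (∑ n ∈ Finset.range N,
      ((-1) ^ (n + 1) * (Nat.centralBinom (n + 1) : K) / 4 ^ (n + 1)) • (w - 1) ^ (n + 1)) 0 := by
    rw [Cong, sub_zero]
    refine sum_mem fun n _ => E.I.smul_mem _ ?_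
    rw [pow_succ]
    exact E.mul_mem_left _ _ h
  simpa using this.add (Cong.refl 1)

section Pol

variable {X Z : 𝔄} (hX : E.Cong X Z) (hZ : Z * Z = -1)

include hX hZ

theorem cong_neg_mul_self : E.Cong (-(X * X)) 1 := by
  simpa [hZ] using (hX.mul hX).neg

theorem isNilpotent_pol : IsNilpotent (-(X * X) - 1) := (cong_neg_mul_self hX hZ).isNilpotent

theorem commute_pol {y : 𝔄} (h : Commute y X) : Commute y (pol K X) :=
  h.mul_right (commute_invSqrt ((h.mul_right h).neg_right) (isNilpotent_pol hX hZ))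

theorem pol_mul_self [CharZero K] : pol K X * pol K X = -1 := by
  have h1 := commute_invSqrt (K := K) (y := X) (x := -(X * X))
    (((Commute.refl X).mul_right (Commute.refl X)).neg_right) (isNilpotent_pol hX hZ)
  have h2 := invSqrt_sq_mul (K := K) (isNilpotent_pol hX hZ)
  have h3 : Commute (invSqrt K (-(X * X))) (X * X) := (h1.mul_left h1).symm
  rw [pol, mul_assoc, ← mul_assoc _ X, ← h1.eq, mul_assoc X, ← mul_assoc,
    ← (h3.mul_left h3).eq, ← neg_eq_iff_eq_neg, ← mul_neg, h2]

theorem pol_cong [CharZero K] : E.Cong (pol K X) Z := by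
  rw [pol]
  simpa only [mul_one] using hX.mul (invSqrt_cong (cong_neg_mul_self hX hZ))

theorem map_pol {𝔅 : Type u} [Ring 𝔅] [Algebra K 𝔅] (φ : 𝔄 →ₐ[K] 𝔅) :
    φ (pol K X) = pol K (φ X) := by
  simp [pol, map_invSqrt φ (isNilpotent_pol hX hZ)]

/-- A polarized element is determined by commutation with the base value. -/
theorem pol_eq_of_commute [CharZero K] (h : Commute Z X) : pol K X = Z :=
  eq_of_mul_self_eq_neg_one (pol_mul_self hX hZ) hZ (commute_pol hX hZ h).symm (pol_cong hX hZ)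

theorem isUnit_of_cong : IsUnit X := by
  have h1 : E.Cong (X * -Z) 1 := by simpa [hZ] using hX.mul (Cong.refl (-Z))
  have h2 : E.Cong (-Z * X) 1 := by simpa [hZ] using (Cong.refl (-Z)).mul hX
  obtain ⟨u, hu⟩ := h1.isUnit
  obtain ⟨v, hv⟩ := h2.isUnit
  refine isUnit_iff_exists_and_exists.mpr ⟨⟨-Z * ↑u⁻¹, ?_⟩, ⟨↑v⁻¹ * -Z, ?_⟩⟩
  · rw [← mul_assoc, ← hu, Units.mul_inv]
  · rw [mul_assoc, ← hv, Units.inv_mul]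

theorem inverse_cong : E.Cong (Ring.inverse X) (-Z) := by
  have h := ((Cong.refl (-Z)).mul hX).mul (Cong.refl (E := E) (Ring.inverse X))
  rw [mul_assoc, Ring.mul_inverse_cancel _ (isUnit_of_cong hX hZ), mul_one, neg_mul, hZ, neg_neg,
    one_mul] at h
  exact h.symm

end Pol

theorem _root_.FQ.map_inverse {𝔅 : Type u} [Ring 𝔅] [Algebra K 𝔅] (φ : 𝔄 →ₐ[K] 𝔅)
    {u : 𝔄} (hu : IsUnit u) : φ (Ring.inverse u) = Ring.inverse (φ u) := by
  obtain ⟨u, rfl⟩ := hu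
  have := Ring.inverse_unit (Units.map (φ : 𝔄 →* 𝔅) u)
  simp at this
  rw [Ring.inverse_unit, this]

/-- Conjugation by a unit. -/
def _root_.FQ.conj (K : Type u) [Field K] [Algebra K 𝔄] (g : 𝔄ˣ) : 𝔄 →ₐ[K] 𝔄 :=
  AlgHom.ofLinearMap (LinearMap.mulLeft K (g : 𝔄) ∘ₗ LinearMap.mulRight K ((g⁻¹ : 𝔄ˣ) : 𝔄))
    (by simp) (fun x y => by simp [mul_assoc])

@[simp]
theorem _root_.FQ.conj_apply (g : 𝔄ˣ) (x : 𝔄) : conj K g x = g * x * (g⁻¹ : 𝔄ˣ) := by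
  simp [conj, mul_assoc]

theorem Cong.units_inv {g : 𝔄ˣ} (h : E.Cong g 1) : E.Cong (g⁻¹ : 𝔄ˣ) 1 := by
  have := h.mul (Cong.refl (E := E) ((g⁻¹ : 𝔄ˣ) : 𝔄))
  simp at this
  exact this.symm

theorem Cong.conj {g : 𝔄ˣ} (hg : E.Cong g 1) (h : E.Cong x y) :
    E.Cong (g * x * (g⁻¹ : 𝔄ˣ)) y := by
  simpa using (hg.mul h).mul hg.units_inv

/-! ### Axes and biaxiality -/

variable (E) in
/-- The axis `Q₁ Q₂` of the base. -/
def J : 𝔄 := E.Q₁ * E.Q₂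

variable (E) in
theorem J_mul_self : E.J * E.J = -1 := by
  rw [J, mul_assoc, ← mul_assoc E.Q₂, ← neg_eq_iff_eq_neg.mpr E.anticomm, neg_mul, mul_neg,
    mul_assoc, E.sq₂, ← mul_assoc, E.sq₁]
  simp

variable (E) in
theorem Q₂_mul_Q₁ : E.Q₂ * E.Q₁ = -E.J := by
  rw [J, E.anticomm, neg_neg]

section Axis

variable {A₁ A₂ : 𝔄} (hA : E.IsPert A₁ A₂)

include hA

theorem IsPert.isUnit₂ : IsUnit A₂ := isUnit_of_cong (E := E) hA.2 E.sq₂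

theorem IsPert.preAxisL_cong : E.Cong (-(A₁ * Ring.inverse A₂)) E.J := by
  have h1 : E.Cong A₁ E.Q₁ := hA.1
  have := (h1.mul (inverse_cong (E := E) hA.2 E.sq₂)).neg
  simpa [J] using this

theorem IsPert.preAxisR_cong : E.Cong (Ring.inverse A₂ * A₁) E.J := by
  have h1 : E.Cong A₁ E.Q₁ := hA.1
  have := (inverse_cong (E := E) hA.2 E.sq₂).mul h1
  simpa [Q₂_mul_Q₁] using this

theorem IsPert.map_axisL {𝔅 : Type u} [Ring 𝔅] [Algebra K 𝔅] (φ : 𝔄 →ₐ[K] 𝔅) :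
    φ (axisL K A₁ A₂) = axisL K (φ A₁) (φ A₂) := by
  rw [axisL, map_pol hA.preAxisL_cong E.J_mul_self, axisL]
  simp [map_inverse φ hA.isUnit₂]

theorem IsPert.map_axisR {𝔅 : Type u} [Ring 𝔅] [Algebra K 𝔅] (φ : 𝔄 →ₐ[K] 𝔅) :
    φ (axisR K A₁ A₂) = axisR K (φ A₁) (φ A₂) := by
  rw [axisR, map_pol hA.preAxisR_cong E.J_mul_self, axisR]
  simp [map_inverse φ hA.isUnit₂]

variable [CharZero K]

theorem IsPert.axisL_cong : E.Cong (axisL K A₁ A₂) E.J := pol_cong hA.preAxisL_cong E.J_mul_self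

theorem IsPert.axisR_cong : E.Cong (axisR K A₁ A₂) E.J := pol_cong hA.preAxisR_cong E.J_mul_self

theorem IsPert.axisL_mul_self : axisL K A₁ A₂ * axisL K A₁ A₂ = -1 :=
  pol_mul_self hA.preAxisL_cong E.J_mul_self

theorem IsPert.axisR_mul_self : axisR K A₁ A₂ * axisR K A₁ A₂ = -1 :=
  pol_mul_self hA.preAxisR_cong E.J_mul_self

theorem IsPert.biax_sq_cong : E.Cong (-(axisL K A₁ A₂ * axisR K A₁ A₂)) 1 := by
  simpa [J_mul_self] using (hA.axisL_cong.mul hA.axisR_cong).neg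

theorem IsPert.map_biax {𝔅 : Type u} [Ring 𝔅] [Algebra K 𝔅] (φ : 𝔄 →ₐ[K] 𝔅) :
    φ (biax K A₁ A₂) = biax K (φ A₁) (φ A₂) := by
  rw [biax, sqrt, map_mul, map_invSqrt φ hA.biax_sq_cong.isNilpotent, biax, sqrt]
  simp [hA.map_axisL, hA.map_axisR]

theorem IsPert.exists_biax : ∃ B : 𝔄ˣ, (B : 𝔄) = biax K A₁ A₂ ∧
    ((B⁻¹ : 𝔄ˣ) : 𝔄) = invSqrt K (-(axisL K A₁ A₂ * axisR K A₁ A₂)) ∧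
    (B : 𝔄) * B = -(axisL K A₁ A₂ * axisR K A₁ A₂) ∧ E.Cong B 1 := by
  have h1 := hA.biax_sq_cong
  set y := -(axisL K A₁ A₂ * axisR K A₁ A₂) with hy
  have hs := invSqrt_sq_mul (K := K) h1.isNilpotent
  have hc := commute_invSqrt (K := K) (Commute.refl y) h1.isNilpotent
  have h2 : y * invSqrt K y * invSqrt K y = 1 := by
    rw [mul_assoc, (hc.mul_right hc).eq, hs]
  have h3 : invSqrt K y * (y * invSqrt K y) = 1 := by
    rw [hc.eq, ← mul_assoc, hs]
  refine ⟨⟨y * invSqrt K y, invSqrt K y, h2, h3⟩, rfl, rfl, ?_, ?_⟩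
  · change y * invSqrt K y * (y * invSqrt K y) = y
    rw [mul_assoc, h3, mul_one]
  · simpa using h1.mul (invSqrt_cong h1)

/-- The biaxiality conjugates the right axis to the left one. -/
theorem IsPert.conj_axisR {B : 𝔄ˣ} (hB : (B : 𝔄) = biax K A₁ A₂) :
    B * axisR K A₁ A₂ * (B⁻¹ : 𝔄ˣ) = axisL K A₁ A₂ := by
  obtain ⟨B', h1, -, h3, h4⟩ := hA.exists_biax
  obtain rfl : B' = B := Units.ext (h1.trans hB.symm)
  have hL := hA.axisL_mul_self
  have hR := hA.axisR_mul_self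
  set L := axisL K A₁ A₂
  set R := axisR K A₁ A₂
  -- Since B² = -LR, one has R = LB², so the claim BR = LB follows from BLB = L.
  have hLB : L * (B' * B') = R := by rw [h3, mul_neg, ← mul_assoc, hL]; simp
  have hBL : B' * B' * L * (B' * B') = L := by
    rw [mul_assoc, hLB, h3, neg_mul, mul_assoc, hR]; simp
  -- The defect ω = BLB - L satisfies BωB = -ω, hence 2ω = (1 - B)ω + ω(1 - B⁻¹) with infinitesimal
  -- factors.
  have hω : (B' : 𝔄) * L * B' - L = 0 := by
    refine eq_zero_of_two_smul_eq (K := K) (E := E) (p := 1 - B')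
      (q := 1 - (B'⁻¹ : 𝔄ˣ)) h4.symm.mem h4.units_inv.symm.mem ?_
    have : (B' : 𝔄) * (B' * L * B' - L) = -((B' * L * B' - L) * (B'⁻¹ : 𝔄ˣ)) := by
      rw [← neg_mul, Units.eq_mul_inv_iff_mul_eq]
      have : (B' : 𝔄) * (B' * L * B' - L) * B' = B' * B' * L * (B' * B') - B' * L * B' := by
        noncomm_ring
      rw [this, hBL]; noncomm_ring
    rw [sub_mul, mul_sub, this, two_smul]
    noncomm_ring
  rw [Units.mul_inv_eq_iff_eq_mul, ← hLB]
  calc (B' : 𝔄) * (L * (B' * B')) = (B' * L * B') * B' := by noncomm_ring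
    _ = L * B' := by rw [sub_eq_zero.mp hω]

theorem IsPert.mul_biax_inv {B : 𝔄ˣ} (hB : (B : 𝔄) = biax K A₁ A₂) :
    E.IsPert (A₁ * (B⁻¹ : 𝔄ˣ)) (A₂ * (B⁻¹ : 𝔄ˣ)) := by
  obtain ⟨B', h1, -, -, h4⟩ := hA.exists_biax
  obtain rfl : B' = B := Units.ext (h1.trans hB.symm)
  have h5 : E.Cong A₁ E.Q₁ := hA.1
  have h6 : E.Cong A₂ E.Q₂ := hA.2
  have h7 := h5.mul h4.units_inv
  have h8 := h6.mul h4.units_inv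
  rw [mul_one] at h7 h8
  exact ⟨h7, h8⟩

omit [CharZero K] in
-- The factors B⁻¹ cancel in A₁A₂⁻¹, for any unit B.
theorem IsPert.axisL_mul_biax_inv {B : 𝔄ˣ} :
    axisL K (A₁ * (B⁻¹ : 𝔄ˣ)) (A₂ * (B⁻¹ : 𝔄ˣ)) = axisL K A₁ A₂ := by
  obtain ⟨u, rfl⟩ := hA.isUnit₂
  rw [axisL, axisL, ← Units.val_mul, Ring.inverse_unit, Ring.inverse_unit, mul_inv_rev, inv_inv,
    Units.val_mul, mul_assoc, Units.inv_mul_cancel_left]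

/-- Here A₂⁻¹A₁ gets conjugated by B, and so does the right axis; for B = ℬ the result is the left
axis. -/
theorem IsPert.axisR_mul_biax_inv {B : 𝔄ˣ} (hB : (B : 𝔄) = biax K A₁ A₂) :
    axisR K (A₁ * (B⁻¹ : 𝔄ˣ)) (A₂ * (B⁻¹ : 𝔄ˣ)) = axisL K A₁ A₂ := by
  rw [← hA.conj_axisR hB, ← conj_apply (K := K), axisR, axisR,
    map_pol hA.preAxisR_cong E.J_mul_self]
  obtain ⟨u, rfl⟩ := hA.isUnit₂
  rw [← Units.val_mul, Ring.inverse_unit, Ring.inverse_unit, mul_inv_rev, inv_inv,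
    Units.val_mul, conj_apply]
  simp only [mul_assoc]

theorem IsPert.isMonoaxial_mul_biax_inv {B : 𝔄ˣ} (hB : (B : 𝔄) = biax K A₁ A₂) :
    E.IsMonoaxial (A₁ * (B⁻¹ : 𝔄ˣ)) (A₂ * (B⁻¹ : 𝔄ˣ)) := by
  rw [IsMonoaxial, hA.axisL_mul_biax_inv, hA.axisR_mul_biax_inv hB]

theorem IsPert.biax_eq_one (h : E.IsMonoaxial A₁ A₂) : biax K A₁ A₂ = 1 := by
  rw [biax, ← show axisL K A₁ A₂ = axisR K A₁ A₂ from h, hA.axisL_mul_self, neg_neg, sqrt,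
    invSqrt_one, one_mul]

omit [CharZero K] in
theorem IsPert.conj {g : 𝔄ˣ} (hg : E.Cong g 1) :
    E.IsPert (g * A₁ * (g⁻¹ : 𝔄ˣ)) (g * A₂ * (g⁻¹ : 𝔄ˣ)) :=
  ⟨Cong.conj hg hA.1, Cong.conj hg hA.2⟩

/-! ### Pairs with the axis of the base -/

/-- If J anticommutes with both entries, it commutes with A₁A₂⁻¹ and A₂⁻¹A₁, and a polarization
commuting with its base value equals it. Conversely, J commutes with both quotients when it is their
axis, and it remains to exclude a part of A₂ that commutes with J. -/
theorem IsPert.isBaseAxial_iff :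
    E.IsBaseAxial A₁ A₂ ↔ E.J * A₁ = -(A₁ * E.J) ∧ E.J * A₂ = -(A₂ * E.J) := by
  have hJ := E.J_mul_self
  have hX := hA.preAxisL_cong
  have hY := hA.preAxisR_cong
  have hu := hA.isUnit₂
  constructor
  · rintro ⟨hL, hR⟩
    have cX : Commute E.J (A₁ * Ring.inverse A₂) := by
      have := commute_pol hX hJ (Commute.refl (-(A₁ * Ring.inverse A₂)))
      rw [show pol K (-(A₁ * Ring.inverse A₂)) = E.J from hL] at this
      simpa using this.symm
    have cY : Commute E.J (Ring.inverse A₂ * A₁) := by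
      have := commute_pol hY hJ (Commute.refl (Ring.inverse A₂ * A₁))
      rw [show pol K (Ring.inverse A₂ * A₁) = E.J from hR] at this
      exact this.symm
    have e1 : A₁ * Ring.inverse A₂ * A₂ = A₁ := by
      rw [mul_assoc, Ring.inverse_mul_cancel _ hu, mul_one]
    have e2 : A₂ * (Ring.inverse A₂ * A₁) = A₁ := by
      rw [← mul_assoc, Ring.mul_inverse_cancel _ hu, one_mul]
    have hX' : E.Cong (A₁ * Ring.inverse A₂) (-E.J) := by simpa using hX.neg
    generalize A₁ * Ring.inverse A₂ = X at *
    generalize Ring.inverse A₂ * A₁ = Y at *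
    -- As J⁻¹ = -J, this is twice the part of A₂ that commutes with J. It satisfies Xd = dY although
    -- X is close to -J and Y to J, which forces d = 0.
    obtain ⟨d, hd⟩ : ∃ d, d = A₂ - E.J * A₂ * E.J := ⟨_, rfl⟩
    have hdJ : d * E.J = E.J * d := by
      rw [hd, sub_mul, mul_sub, mul_assoc (E.J * A₂), hJ, ← mul_assoc, ← mul_assoc E.J E.J A₂, hJ]
      noncomm_ring
    have hXd : X * d = d * Y := by
      rw [hd, mul_sub, sub_mul, e1, e2, ← mul_assoc, ← mul_assoc, ← cX.eq, mul_assoc E.J, e1,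
        mul_assoc (E.J * A₂), cY.eq, ← e2]
      simp only [mul_assoc]
    have hd0 : d = 0 := by
      refine eq_zero_of_two_smul_eq (K := K) (E := E) (p := -E.J * (X - -E.J))
        (q := E.J * (Y - E.J)) (E.mul_mem_left _ _ hX') (E.mul_mem_left _ _ hY) ?_
      have : -E.J * (X - -E.J) * d + d * (E.J * (Y - E.J))
          = -(E.J * (X * d)) - E.J * E.J * d + d * E.J * Y - d * (E.J * E.J) := by noncomm_ring
      rw [this, hJ, hdJ, hXd, two_smul]
      noncomm_ring
    rw [hd, sub_eq_zero] at hd0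
    have h2 : E.J * A₂ = -(A₂ * E.J) := by
      conv_lhs => rw [hd0]
      rw [← mul_assoc, ← mul_assoc, hJ]
      noncomm_ring
    refine ⟨?_, h2⟩
    rw [← e1, ← mul_assoc, cX.eq, mul_assoc, h2, mul_neg, mul_assoc]
  · rintro ⟨h1, h2⟩
    have c2 : E.J * Ring.inverse A₂ = -(Ring.inverse A₂ * E.J) := by
      obtain ⟨u, rfl⟩ := hu
      rw [Ring.inverse_unit, ← mul_neg, Units.eq_inv_mul_iff_mul_eq, ← mul_assoc,
        Units.mul_inv_eq_iff_eq_mul, neg_mul, h2, neg_neg]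
    change pol K _ = E.J ∧ pol K _ = E.J
    refine ⟨pol_eq_of_commute hX hJ ?_, pol_eq_of_commute hY hJ ?_⟩
    · refine Commute.neg_right ?_
      rw [Commute, SemiconjBy, ← mul_assoc, h1, neg_mul, mul_assoc, c2, mul_neg, neg_neg, mul_assoc]
    · rw [Commute, SemiconjBy, ← mul_assoc, c2, neg_mul, mul_assoc, h1, mul_neg, neg_neg, mul_assoc]

end Axis

end Env

/-! ### The mixed base and conjugation by `Q₁` and `Q₂` -/

namespace MixedIndex

/-- The permutation of the lower indices by which conjugation with `Q₁` or `Q₂` acts. -/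
def swap : MixedIndex → MixedIndex
  | i1 => i2 | i2 => i1 | i3 => i3 | i4 => i4 | i5 => i5 | i6 => i6 | i7 => i8 | i8 => i7

/-- The signs by which conjugation with `Q₁` acts. -/
def sign₁ : MixedIndex → ℤ
  | i1 => 1 | i2 => 1 | i3 => 1 | i4 => 1 | i5 => -1 | i6 => -1 | i7 => -1 | i8 => -1

/-- The signs by which conjugation with `Q₂` acts. -/
def sign₂ : MixedIndex → ℤ
  | i1 => -1 | i2 => -1 | i3 => 1 | i4 => 1 | i5 => -1 | i6 => -1 | i7 => 1 | i8 => 1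

instance : Finite MixedIndex :=
  Finite.of_surjective (fun n : Fin 8 => ![i1, i2, i3, i4, i5, i6, i7, i8] n) fun i => by
    cases i
    exacts [⟨0, rfl⟩, ⟨1, rfl⟩, ⟨2, rfl⟩, ⟨3, rfl⟩, ⟨4, rfl⟩, ⟨5, rfl⟩, ⟨6, rfl⟩, ⟨7, rfl⟩]

end MixedIndex

namespace Env

open MixedIndex

variable {K : Type u} {𝔄 : Type u} [Field K] [Ring 𝔄] [Algebra K 𝔄] (E : Env K 𝔄)

/-- `Q₁` as a unit. -/
def unit₁ : 𝔄ˣ := ⟨E.Q₁, -E.Q₁, by simp [E.sq₁], by simp [E.sq₁]⟩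

/-- `Q₂` as a unit. -/
def unit₂ : 𝔄ˣ := ⟨E.Q₂, -E.Q₂, by simp [E.sq₂], by simp [E.sq₂]⟩

/-- Conjugation by `Q₁`. -/
def σ₁ : 𝔄 →ₐ[K] 𝔄 := conj K E.unit₁

/-- Conjugation by `Q₂`. -/
def σ₂ : 𝔄 →ₐ[K] 𝔄 := conj K E.unit₂

theorem σ₁_apply (x : 𝔄) : E.σ₁ x = -(E.Q₁ * x * E.Q₁) := by simp [σ₁, unit₁]

theorem σ₂_apply (x : 𝔄) : E.σ₂ x = -(E.Q₂ * x * E.Q₂) := by simp [σ₂, unit₂]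

theorem Q₁_mul (x : 𝔄) : E.Q₁ * x = E.σ₁ x * E.Q₁ := by
  rw [σ₁_apply, neg_mul, mul_assoc, E.sq₁]; simp

theorem Q₂_mul (x : 𝔄) : E.Q₂ * x = E.σ₂ x * E.Q₂ := by
  rw [σ₂_apply, neg_mul, mul_assoc, E.sq₂]; simp

theorem σ₁_σ₂_apply (x : 𝔄) : E.σ₁ (E.σ₂ x) = -(E.J * x * E.J) := by
  rw [σ₁_apply, σ₂_apply]
  have : E.J * x * E.J = -(E.Q₁ * E.Q₂ * x * (E.Q₂ * E.Q₁)) := by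
    rw [Q₂_mul_Q₁, J]; simp
  rw [this]; noncomm_ring

@[simp]
theorem σ₁_σ₁ (x : 𝔄) : E.σ₁ (E.σ₁ x) = x := by
  rw [σ₁_apply, σ₁_apply, show -(E.Q₁ * -(E.Q₁ * x * E.Q₁) * E.Q₁)
    = (E.Q₁ * E.Q₁) * x * (E.Q₁ * E.Q₁) by noncomm_ring, E.sq₁]
  simp

@[simp]
theorem σ₂_σ₂ (x : 𝔄) : E.σ₂ (E.σ₂ x) = x := by
  rw [σ₂_apply, σ₂_apply, show -(E.Q₂ * -(E.Q₂ * x * E.Q₂) * E.Q₂)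
    = (E.Q₂ * E.Q₂) * x * (E.Q₂ * E.Q₂) by noncomm_ring, E.sq₂]
  simp

@[simp]
theorem σ₂_σ₁ (x : 𝔄) : E.σ₂ (E.σ₁ x) = E.σ₁ (E.σ₂ x) := by
  rw [σ₁_σ₂_apply, σ₁_apply, σ₂_apply]
  have h := E.Q₂_mul_Q₁
  rw [show -(E.Q₂ * -(E.Q₁ * x * E.Q₁) * E.Q₂) = (E.Q₂ * E.Q₁) * x * (E.Q₁ * E.Q₂) by noncomm_ring,
    h, ← J]
  noncomm_ring

variable {E} in
theorem σ₁_mem {x : 𝔄} (h : x ∈ E.I) : E.σ₁ x ∈ E.I := by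
  rw [σ₁_apply]
  exact neg_mem (E.mul_mem_right _ _ (E.mul_mem_left _ _ h))

variable {E} in
theorem σ₂_mem {x : 𝔄} (h : x ∈ E.I) : E.σ₂ x ∈ E.I := by
  rw [σ₂_apply]
  exact neg_mem (E.mul_mem_right _ _ (E.mul_mem_left _ _ h))

/-- `a`, where `A₁ = (1 + a) Q₁`. -/
def fst (A₁ : 𝔄) : 𝔄 := -(A₁ * E.Q₁) - 1

/-- `b`, where `A₂ = (1 + b) Q₂`. -/
def snd (A₂ : 𝔄) : 𝔄 := -(A₂ * E.Q₂) - 1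

theorem one_add_fst_mul (A₁ : 𝔄) : (1 + E.fst A₁) * E.Q₁ = A₁ := by
  rw [fst, add_sub_cancel, neg_mul, mul_assoc, E.sq₁]; simp

theorem one_add_snd_mul (A₂ : 𝔄) : (1 + E.snd A₂) * E.Q₂ = A₂ := by
  rw [snd, add_sub_cancel, neg_mul, mul_assoc, E.sq₂]; simp

theorem fst_one_add_mul (a : 𝔄) : E.fst ((1 + a) * E.Q₁) = a := by
  rw [fst, mul_assoc, E.sq₁]; simp

theorem snd_one_add_mul (b : 𝔄) : E.snd ((1 + b) * E.Q₂) = b := by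
  rw [snd, mul_assoc, E.sq₂]; simp

variable {E} in
theorem IsPert.fst_mem {A₁ A₂ : 𝔄} (h : E.IsPert A₁ A₂) : E.fst A₁ ∈ E.I := by
  have := E.mul_mem_right E.Q₁ _ h.1
  rw [sub_mul, E.sq₁] at this
  have h2 := neg_mem this
  rwa [show -(A₁ * E.Q₁ - -1) = E.fst A₁ by rw [fst]; abel] at h2

variable {E} in
theorem IsPert.snd_mem {A₁ A₂ : 𝔄} (h : E.IsPert A₁ A₂) : E.snd A₂ ∈ E.I := by
  have := E.mul_mem_right E.Q₂ _ h.2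
  rw [sub_mul, E.sq₂] at this
  have h2 := neg_mem this
  rwa [show -(A₂ * E.Q₂ - -1) = E.snd A₂ by rw [snd]; abel] at h2

theorem part_eq (ε₁ ε₂ : ℤˣ) (x : 𝔄) : E.part ε₁ ε₂ x = (4⁻¹ : K) • (x + (ε₁ : ℤ) • E.σ₁ x
    + (ε₂ : ℤ) • E.σ₂ x + ((ε₁ * ε₂ : ℤˣ) : ℤ) • E.σ₁ (E.σ₂ x)) := by
  rw [part, σ₁_σ₂_apply, σ₁_apply, σ₂_apply, J]
  simp only [smul_neg, sub_eq_add_neg]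

/-- The components of `(a, b)` in the mixed base. -/
def mix (a b : 𝔄) : MixedIndex → 𝔄
  | .i1 => (8⁻¹ : K) • (a + E.σ₁ a - E.σ₂ a - E.σ₁ (E.σ₂ a)
      - (b - E.σ₁ b + E.σ₂ b - E.σ₁ (E.σ₂ b)))
  | .i2 => (8⁻¹ : K) • (a + E.σ₁ a - E.σ₂ a - E.σ₁ (E.σ₂ a)
      + (b - E.σ₁ b + E.σ₂ b - E.σ₁ (E.σ₂ b)))
  | .i3 => (8⁻¹ : K) • (a + E.σ₁ a + E.σ₂ a + E.σ₁ (E.σ₂ a)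
      + (b + E.σ₁ b + E.σ₂ b + E.σ₁ (E.σ₂ b)))
  | .i4 => (8⁻¹ : K) • (a + E.σ₁ a + E.σ₂ a + E.σ₁ (E.σ₂ a)
      - (b + E.σ₁ b + E.σ₂ b + E.σ₁ (E.σ₂ b)))
  | .i5 => (8⁻¹ : K) • (a - E.σ₁ a - E.σ₂ a + E.σ₁ (E.σ₂ a)
      - (b - E.σ₁ b - E.σ₂ b + E.σ₁ (E.σ₂ b)))
  | .i6 => (8⁻¹ : K) • (a - E.σ₁ a - E.σ₂ a + E.σ₁ (E.σ₂ a)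
      + (b - E.σ₁ b - E.σ₂ b + E.σ₁ (E.σ₂ b)))
  | .i7 => (8⁻¹ : K) • (a - E.σ₁ a + E.σ₂ a - E.σ₁ (E.σ₂ a)
      + (b + E.σ₁ b - E.σ₂ b - E.σ₁ (E.σ₂ b)))
  | .i8 => (8⁻¹ : K) • (a - E.σ₁ a + E.σ₂ a - E.σ₁ (E.σ₂ a)
      - (b + E.σ₁ b - E.σ₂ b - E.σ₁ (E.σ₂ b)))

theorem mix_add (a b a' b' : 𝔄) (i : MixedIndex) :
    E.mix (a + a') (b + b') i = E.mix a b i + E.mix a' b' i := by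
  cases i <;> simp only [mix, map_add] <;> module

theorem mix_mem {M : Submodule K 𝔄} (h₁ : ∀ x ∈ M, E.σ₁ x ∈ M) (h₂ : ∀ x ∈ M, E.σ₂ x ∈ M)
    {a b : 𝔄} (ha : a ∈ M) (hb : b ∈ M) (i : MixedIndex) : E.mix a b i ∈ M := by
  have := h₁ _ (h₂ _ ha)
  have := h₁ _ (h₂ _ hb)
  have := h₁ _ ha
  have := h₁ _ hb
  have := h₂ _ ha
  have := h₂ _ hb
  cases i <;> refine M.smul_mem _ ?_ <;>
    first | refine sub_mem ?_ ?_ | refine add_mem ?_ ?_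
  all_goals
    repeat' first | assumption | apply add_mem | apply sub_mem

variable [CharZero K]

theorem r_eq_mix (A₁ A₂ : 𝔄) (i : MixedIndex) : E.r A₁ A₂ i = E.mix (E.fst A₁) (E.snd A₂) i := by
  cases i <;> simp [r, mix, part_eq, fst, snd] <;> module

/-- The indices 3, 4, 5, 6 combine parts of a and b of equal signature, so conjugation acts by a
sign. The indices 1, 2, 7, 8 combine opposite signatures, so the sum and the difference are
interchanged. -/
theorem σ₁_mix (a b : 𝔄) (i : MixedIndex) :
    E.σ₁ (E.mix a b i) = sign₁ i • E.mix a b (swap i) := by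
  cases i <;> simp [mix, sign₁, swap] <;> module

theorem σ₂_mix (a b : 𝔄) (i : MixedIndex) :
    E.σ₂ (E.mix a b i) = sign₂ i • E.mix a b (swap i) := by
  cases i <;> simp [mix, sign₂, swap] <;> module

theorem fst_eq_sum_mix (a b : 𝔄) : a = E.mix a b .i1 + E.mix a b .i2 + E.mix a b .i3
    + E.mix a b .i4 + E.mix a b .i5 + E.mix a b .i6 + E.mix a b .i7 + E.mix a b .i8 := by
  simp [mix]; module

theorem snd_eq_sum_mix (a b : 𝔄) : b = -E.mix a b .i1 + E.mix a b .i2 + E.mix a b .i3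
    - E.mix a b .i4 - E.mix a b .i5 + E.mix a b .i6 + E.mix a b .i7 - E.mix a b .i8 := by
  simp [mix]; module

/-- The components in the mixed base can be prescribed. -/
theorem mix_eq {x : MixedIndex → 𝔄} (h₁ : ∀ i, E.σ₁ (x i) = sign₁ i • x (swap i))
    (h₂ : ∀ i, E.σ₂ (x i) = sign₂ i • x (swap i)) (i : MixedIndex) :
    E.mix (x .i1 + x .i2 + x .i3 + x .i4 + x .i5 + x .i6 + x .i7 + x .i8)
      (-x .i1 + x .i2 + x .i3 - x .i4 - x .i5 + x .i6 + x .i7 - x .i8) i = x i := by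
  cases i <;> simp [mix, h₁, h₂, sign₁, sign₂, swap] <;> module

theorem IsPert.r_mem {E : Env K 𝔄} {A₁ A₂ : 𝔄} (h : E.IsPert A₁ A₂) (i : MixedIndex) :
    E.r A₁ A₂ i ∈ E.I := by
  rw [r_eq_mix]
  exact E.mix_mem (fun _ => σ₁_mem) (fun _ => σ₂_mem) h.fst_mem h.snd_mem i

theorem map_r {𝔅 : Type u} [Ring 𝔅] [Algebra K 𝔅] (E' : Env K 𝔅) (φ : 𝔄 →ₐ[K] 𝔅)
    (h₁ : φ E.Q₁ = E'.Q₁) (h₂ : φ E.Q₂ = E'.Q₂) (A₁ A₂ : 𝔄) (i : MixedIndex) :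
    φ (E.r A₁ A₂ i) = E'.r (φ A₁) (φ A₂) i := by
  have e₁ : ∀ x, φ (E.σ₁ x) = E'.σ₁ (φ x) := fun x => by simp [σ₁_apply, h₁]
  have e₂ : ∀ x, φ (E.σ₂ x) = E'.σ₂ (φ x) := fun x => by simp [σ₂_apply, h₂]
  have ea : φ (E.fst A₁) = E'.fst (φ A₁) := by simp [fst, h₁]
  have eb : φ (E.snd A₂) = E'.snd (φ A₂) := by simp [snd, h₂]
  rw [r_eq_mix, r_eq_mix, ← ea, ← eb]
  cases i <;> simp [mix, e₁, e₂]

/-! ### The axis of the base in terms of the mixed base -/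

omit [CharZero K] in
theorem σ₁_σ₂_fst {A₁ : 𝔄} (h : E.J * A₁ = -(A₁ * E.J)) : E.σ₁ (E.σ₂ (E.fst A₁)) = E.fst A₁ := by
  have hA : E.σ₁ (E.σ₂ A₁) = -A₁ := by
    rw [σ₁_σ₂_apply, h, neg_mul, mul_assoc, J_mul_self]; simp
  have hQ : E.σ₁ (E.σ₂ E.Q₁) = -E.Q₁ := by
    rw [σ₁_σ₂_apply, J, mul_assoc E.Q₁, ← J, Q₂_mul_Q₁, mul_neg, neg_mul, mul_assoc, J_mul_self]
    simp
  simp [fst, hA, hQ]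

omit [CharZero K] in
theorem σ₁_σ₂_snd {A₂ : 𝔄} (h : E.J * A₂ = -(A₂ * E.J)) : E.σ₁ (E.σ₂ (E.snd A₂)) = E.snd A₂ := by
  have hA : E.σ₁ (E.σ₂ A₂) = -A₂ := by
    rw [σ₁_σ₂_apply, h, neg_mul, mul_assoc, J_mul_self]; simp
  have hQ : E.σ₁ (E.σ₂ E.Q₂) = -E.Q₂ := by
    rw [σ₁_σ₂_apply, J, mul_assoc E.Q₁, E.sq₂, mul_assoc, ← J]
    simp only [mul_neg, neg_mul, neg_neg, J]
    rw [one_mul, ← mul_assoc, E.sq₁]; simp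
  simp [snd, hA, hQ]

/-- Anticommutation with J says that σ₁σ₂ fixes a and b, so that their parts of signature +- and -+
vanish; the components 1, 2, 7, 8 consist of exactly these parts. -/
theorem anticommute_J_iff (A₁ A₂ : 𝔄) :
    (E.J * A₁ = -(A₁ * E.J) ∧ E.J * A₂ = -(A₂ * E.J)) ↔
      E.r A₁ A₂ .i1 = 0 ∧ E.r A₁ A₂ .i2 = 0 ∧ E.r A₁ A₂ .i7 = 0 ∧ E.r A₁ A₂ .i8 = 0 := by
  simp only [r_eq_mix]
  constructor
  · rintro ⟨h1, h2⟩
    have ha := E.σ₁_σ₂_fst h1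
    have hb := E.σ₁_σ₂_snd h2
    have ha' := congrArg E.σ₁ ha
    have hb' := congrArg E.σ₁ hb
    rw [σ₁_σ₁] at ha' hb'
    refine ⟨?_, ?_, ?_, ?_⟩ <;> simp only [mix, ha, hb] <;> rw [ha', hb'] <;> module
  · rintro ⟨h1, h2, h7, h8⟩
    have ha := E.fst_eq_sum_mix (E.fst A₁) (E.snd A₂)
    have hb := E.snd_eq_sum_mix (E.fst A₁) (E.snd A₂)
    simp only [h1, h2, h7, h8] at ha hb
    have ha' : E.σ₁ (E.σ₂ (E.fst A₁)) = E.fst A₁ := by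
      rw [ha]; simp [σ₁_mix, σ₂_mix, swap, sign₁, sign₂]
    have hb' : E.σ₁ (E.σ₂ (E.snd A₂)) = E.snd A₂ := by
      rw [hb]; simp [σ₁_mix, σ₂_mix, swap, sign₁, sign₂, sub_eq_add_neg]
    have hJ : ∀ x, E.J * x = E.σ₁ (E.σ₂ x) * E.J := fun x => by
      rw [σ₁_σ₂_apply, neg_mul, mul_assoc, J_mul_self]; simp
    constructor
    · rw [← E.one_add_fst_mul A₁, ← mul_assoc, hJ, map_add, map_add, map_one, map_one, ha',
        mul_assoc, mul_assoc, J, ← mul_neg, mul_assoc, Q₂_mul_Q₁, J, mul_neg]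
    · rw [← E.one_add_snd_mul A₂, ← mul_assoc, hJ, map_add, map_add, map_one, map_one, hb',
        mul_assoc, mul_assoc, J, ← mul_neg, mul_assoc, ← mul_assoc E.Q₂, Q₂_mul_Q₁, J, neg_mul,
        neg_neg, mul_assoc]

end Env

/-! ### The normal form and its uniqueness -/

namespace Env

open MixedIndex

variable {K : Type u} {𝔄 : Type u} [Field K] [CharZero K] [Ring 𝔄] [Algebra K 𝔄] {E : Env K 𝔄}

variable (E) in
/-- A pair is in normal form if only its components with lower indices `3, 4, 5` are nonzero. -/
def IsNormal (A₁ A₂ : 𝔄) : Prop :=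
  ∀ i ∉ ({.i3, .i4, .i5} : Set MixedIndex), E.r A₁ A₂ i = 0

/-- The average of `A₁` and `A₂ J`. -/
def avg (E : Env K 𝔄) (A₁ A₂ : 𝔄) : 𝔄 := (2⁻¹ : K) • (A₁ + A₂ * E.J)

omit [CharZero K] in
theorem Q₂_mul_J : E.Q₂ * E.J = E.Q₁ := by
  have h := E.Q₂_mul_Q₁
  rw [J, ← mul_assoc, h, neg_mul, J, mul_assoc, E.sq₂]; simp

omit [CharZero K] in
theorem avg_eq (A₁ A₂ : 𝔄) :
    E.avg A₁ A₂ = (2⁻¹ : K) • ((1 + E.fst A₁) + (1 + E.snd A₂)) * E.Q₁ := by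
  conv_lhs => rw [avg, ← E.one_add_fst_mul A₁, ← E.one_add_snd_mul A₂]
  rw [mul_assoc _ E.Q₂, Q₂_mul_J, ← add_mul, smul_mul_assoc]

theorem IsPert.avg_cong {A₁ A₂ : 𝔄} (h : E.IsPert A₁ A₂) : E.Cong (E.avg A₁ A₂) E.Q₁ := by
  have h1 : E.Cong A₁ E.Q₁ := h.1
  have h2 : E.Cong A₂ E.Q₂ := h.2
  have := (h1.add (h2.mul (Cong.refl E.J))).smul (2⁻¹ : K)
  rwa [Q₂_mul_J, ← two_smul K E.Q₁, smul_smul, inv_mul_cancel₀ two_ne_zero, one_smul] at this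

/-- The average is (1 + (a + b)/2)Q₁, so it commutes with Q₁ when σ₁ fixes a + b. Once the
components 1, 2, 7, 8 vanish, this says that the -- part of a + b, which is twice component 6, is
zero. -/
theorem isNormal_iff (A₁ A₂ : 𝔄) : E.IsNormal A₁ A₂ ↔
    (E.J * A₁ = -(A₁ * E.J) ∧ E.J * A₂ = -(A₂ * E.J)) ∧ Commute E.Q₁ (E.avg A₁ A₂) := by
  have hcomm : Commute E.Q₁ (E.avg A₁ A₂) ↔
      E.σ₁ (E.fst A₁ + E.snd A₂) = E.fst A₁ + E.snd A₂ := by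
    rw [Commute, SemiconjBy, Q₁_mul]
    have hu : IsUnit E.Q₁ := E.unit₁.isUnit
    rw [hu.mul_left_inj]
    rw [avg_eq, map_mul, show E.σ₁ E.Q₁ = E.Q₁ by rw [σ₁_apply, E.sq₁]; simp, hu.mul_left_inj,
      map_smul, (smul_right_injective 𝔄 (inv_ne_zero (two_ne_zero (α := K)))).eq_iff]
    simp only [map_add, map_one]
    constructor
    · intro h
      have := congrArg (· - 2) h
      simpa [add_add_add_comm, one_add_one_eq_two] using this
    · intro h
      rw [add_add_add_comm, h, add_add_add_comm]
  rw [anticommute_J_iff, hcomm]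
  constructor
  · intro h
    have h1 := h .i1 (by simp)
    have h2 := h .i2 (by simp)
    have h6 := h .i6 (by simp)
    have h7 := h .i7 (by simp)
    have h8 := h .i8 (by simp)
    refine ⟨⟨h1, h2, h7, h8⟩, ?_⟩
    simp only [r_eq_mix] at *
    have hs := congrArg₂ (· + ·) (E.fst_eq_sum_mix (E.fst A₁) (E.snd A₂))
      (E.snd_eq_sum_mix (E.fst A₁) (E.snd A₂))
    simp only [h1, h2, h6, h7, h8] at hs
    rw [hs]
    simp [σ₁_mix, sign₁, swap]
  · rintro ⟨⟨h1, h2, h7, h8⟩, h⟩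
    have h' := (E.anticommute_J_iff A₁ A₂).mpr ⟨h1, h2, h7, h8⟩
    have ha := congrArg E.σ₁ (E.σ₁_σ₂_fst h'.1)
    have hb := congrArg E.σ₁ (E.σ₁_σ₂_snd h'.2)
    rw [σ₁_σ₁] at ha hb
    have h6 : E.r A₁ A₂ .i6 = 0 := by
      rw [r_eq_mix, mix, ha, hb, σ₁_σ₁, σ₁_σ₁]
      rw [map_add] at h
      have hb' : E.σ₁ (E.snd A₂) = E.fst A₁ + E.snd A₂ - E.σ₁ (E.fst A₁) := by rw [← h]; abel
      rw [hb']; module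
    intro i hi
    cases i <;> first | assumption | simp at hi

/-! ### Graded elements over a subalgebra that is stable under conjugation by `Q₁`, `Q₂` -/

variable {R : Subalgebra K 𝔄}

/-- The inverse is the square of the binomial series for g^{-1/2}. Membership in R is tracked
because R will later be generated by the components, so that everything in it expands into words. -/
theorem inv_mem {g : 𝔄ˣ} (hg : E.Cong g 1) (h : (g : 𝔄) ∈ R) : ((g⁻¹ : 𝔄ˣ) : 𝔄) ∈ R := by
  have := invSqrt_sq_mul (K := K) hg.isNilpotent
  rw [← Units.eq_mul_inv_iff_mul_eq, one_mul] at this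
  rw [← this]
  exact mul_mem (invSqrt_mem R h hg.isNilpotent) (invSqrt_mem R h hg.isNilpotent)

omit [CharZero K] in
-- The negated square of ρu is ρτ(ρ), which lies in R together with its inverse square root; the
-- latter is moved to the left of u by τ.
theorem exists_pol_eq {u ρ : 𝔄} {τ : 𝔄 → 𝔄} (hu : u * u = -1) (hτ : ∀ x, u * x = τ x * u)
    (hR : ∀ x ∈ R, τ x ∈ R) (hρ : ρ ∈ R) (h : E.Cong (ρ * u) u) :
    ∃ ρ' ∈ R, pol K (ρ * u) = ρ' * u := by
  have h1 : -(ρ * u * (ρ * u)) ∈ R := by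
    rw [mul_assoc, ← mul_assoc u, hτ, mul_assoc, hu]
    simpa using mul_mem hρ (hR _ hρ)
  refine ⟨_, mul_mem hρ (hR _ (invSqrt_mem R h1 (isNilpotent_pol h hu))), ?_⟩
  rw [pol]
  generalize invSqrt K (-(ρ * u * (ρ * u))) = s
  rw [mul_assoc, hτ, mul_assoc]

omit [CharZero K] in
theorem exists_conj_eq {u X : 𝔄} {τ : 𝔄 → 𝔄} (hτ : ∀ x, u * x = τ x * u)
    (hR : ∀ x ∈ R, τ x ∈ R) (hX : ∃ ρ ∈ R, X = ρ * u) {x y : 𝔄} (hx : x ∈ R) (hy : y ∈ R) :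
    ∃ ρ ∈ R, x * X * y = ρ * u := by
  obtain ⟨ρ, hρ, rfl⟩ := hX
  exact ⟨x * ρ * τ y, mul_mem (mul_mem hx hρ) (hR _ hy), by simp only [mul_assoc, hτ]⟩

variable (hR₁ : ∀ x ∈ R, E.σ₁ x ∈ R) (hR₂ : ∀ x ∈ R, E.σ₂ x ∈ R) {A₁ A₂ : 𝔄}
  (hA : E.IsPert A₁ A₂)

omit [CharZero K] in
theorem J_mul (x : 𝔄) : E.J * x = E.σ₁ (E.σ₂ x) * E.J := by
  rw [σ₁_σ₂_apply, neg_mul, mul_assoc, J_mul_self]; simp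

include hR₁ hA in
/-- A pair with the axis of the base can be conjugated to normal form. -/
theorem exists_normalizer_of_isBaseAxial (h : E.IsBaseAxial A₁ A₂)
    (h₁ : ∃ ρ ∈ R, A₁ = ρ * E.Q₁) (h₂ : ∃ ρ ∈ R, A₂ = ρ * E.Q₂) :
    ∃ g : 𝔄ˣ, E.Cong g 1 ∧ (g : 𝔄) ∈ R ∧ Commute E.J g ∧
      E.IsNormal (g * A₁ * (g⁻¹ : 𝔄ˣ)) (g * A₂ * (g⁻¹ : 𝔄ˣ)) := by
  obtain ⟨hJ₁, hJ₂⟩ := hA.isBaseAxial_iff.mp h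
  have hD := hA.avg_cong
  have hJQ : E.J * E.Q₁ = -(E.Q₁ * E.J) := by
    rw [J, mul_assoc, Q₂_mul_Q₁, J, mul_neg]
  have hJD : E.J * E.avg A₁ A₂ = -(E.avg A₁ A₂ * E.J) := by
    rw [avg, mul_smul_comm, mul_add, hJ₁, ← mul_assoc, hJ₂, smul_mul_assoc, add_mul, ← smul_neg,
      neg_mul, neg_add]
  have hDR : ∃ ρ ∈ R, pol K (E.avg A₁ A₂) = ρ * E.Q₁ := by
    have e : E.avg A₁ A₂ = (2⁻¹ : K) • ((1 + E.fst A₁) + (1 + E.snd A₂)) * E.Q₁ := avg_eq A₁ A₂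
    obtain ⟨ρ₁, hρ₁, rfl⟩ := h₁
    obtain ⟨ρ₂, hρ₂, rfl⟩ := h₂
    rw [e] at hD ⊢
    refine exists_pol_eq (τ := E.σ₁) E.sq₁ E.Q₁_mul hR₁ ?_ hD
    refine R.smul_mem (add_mem ?_ ?_) _
    · simpa [fst, mul_assoc, E.sq₁] using hρ₁
    · simpa [snd, mul_assoc, E.sq₂] using hρ₂
  have hP := pol_mul_self hD E.sq₁
  have hc := commute_pol hD E.sq₁ (Commute.refl (E.avg A₁ A₂))
  have hJP : E.J * pol K (E.avg A₁ A₂) = -(pol K (E.avg A₁ A₂) * E.J) := by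
    have hn := isNilpotent_pol hD E.sq₁
    have : Commute E.J (invSqrt K (-(E.avg A₁ A₂ * E.avg A₁ A₂))) := by
      refine commute_invSqrt (Commute.neg_right ?_) hn
      rw [Commute, SemiconjBy, ← mul_assoc, hJD, neg_mul, mul_assoc, hJD, mul_neg, neg_neg,
        mul_assoc]
    rw [pol, ← mul_assoc, hJD, neg_mul, mul_assoc, this.eq, mul_assoc]
  -- The rotation from the polarized average to Q₁ commutes with J, because both ends anticommute
  -- with J; hence it preserves the axis already reached.
  obtain ⟨g, hg, hg1, hgP⟩ := exists_rotation hP E.sq₁ (pol_cong hD E.sq₁)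
  obtain ⟨ρ, hρ, hρP⟩ := hDR
  have hJg : Commute E.J g := by
    rw [hg]
    refine Commute.smul_right ((Commute.one_right _).sub_right ?_) _
    rw [Commute, SemiconjBy, ← mul_assoc, hJQ, neg_mul, mul_assoc, hJP, mul_neg, neg_neg, mul_assoc]
  have hJg' : Commute E.J (g⁻¹ : 𝔄ˣ) := hJg.units_inv_right
  have hcJ : ∀ X, E.J * X = -(X * E.J) →
      E.J * (g * X * (g⁻¹ : 𝔄ˣ)) = -((g * X * (g⁻¹ : 𝔄ˣ)) * E.J) := fun X hX => by
    rw [← mul_assoc, ← mul_assoc, hJg.eq, mul_assoc (g : 𝔄), hX, mul_assoc _ _ E.J, ← hJg'.eq]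
    simp only [mul_assoc, mul_neg, neg_mul]
  refine ⟨g, hg1, ?_, hJg, ?_⟩
  · rw [hg, hρP, Q₁_mul, map_mul, mul_assoc, show E.σ₁ E.Q₁ = E.Q₁ by rw [σ₁_apply, E.sq₁]; simp,
      E.sq₁]
    exact R.smul_mem (sub_mem (one_mem _) (by simpa using hR₁ _ hρ)) _
  · rw [isNormal_iff]
    refine ⟨⟨hcJ _ hJ₁, hcJ _ hJ₂⟩, ?_⟩
    have e : E.avg (g * A₁ * (g⁻¹ : 𝔄ˣ)) (g * A₂ * (g⁻¹ : 𝔄ˣ))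
        = conj K g (E.avg A₁ A₂) := by
      rw [conj_apply, avg, avg, mul_assoc _ _ E.J, ← hJg'.eq]
      simp only [mul_assoc, mul_add, add_mul, mul_smul_comm, smul_mul_assoc]
    rw [e, ← hgP, ← conj_apply (K := K)]
    exact hc.symm.map (conj K g)

include hR₁ hR₂ hA in
/-- After division by the biaxiality, every pair can be conjugated to normal form. -/
theorem exists_normalizer (h₁ : ∃ ρ ∈ R, A₁ = ρ * E.Q₁) (h₂ : ∃ ρ ∈ R, A₂ = ρ * E.Q₂) :
    ∃ B g : 𝔄ˣ, (B : 𝔄) = biax K A₁ A₂ ∧ E.Cong g 1 ∧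
      (B : 𝔄) ∈ R ∧ (g : 𝔄) ∈ R ∧ ((B⁻¹ : 𝔄ˣ) : 𝔄) ∈ R ∧
      E.IsNormal (g * (A₁ * (B⁻¹ : 𝔄ˣ)) * (g⁻¹ : 𝔄ˣ)) (g * (A₂ * (B⁻¹ : 𝔄ˣ)) * (g⁻¹ : 𝔄ˣ)) := by
  have hRJ : ∀ x ∈ R, E.σ₁ (E.σ₂ x) ∈ R := fun x hx => hR₁ _ (hR₂ _ hx)
  have hLR : (∃ ρ ∈ R, -(A₁ * Ring.inverse A₂) = ρ * E.J) ∧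
      (∃ ρ ∈ R, Ring.inverse A₂ * A₁ = ρ * E.J) := by
    obtain ⟨ρ₁, hρ₁, rfl⟩ := h₁
    obtain ⟨ρ₂, hρ₂, rfl⟩ := h₂
    have hc : E.Cong ρ₂ 1 := by
      have : E.Cong (ρ₂ * E.Q₂) E.Q₂ := hA.2
      simpa [mul_assoc, E.sq₂] using (this.mul (Cong.refl E.Q₂)).neg
    obtain ⟨β, rfl⟩ := hc.isUnit
    have hβ := inv_mem hc hρ₂
    have hinv : Ring.inverse (β * E.Q₂) = -(E.Q₂ * (β⁻¹ : 𝔄ˣ)) := by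
      have := Ring.inverse_unit (β * E.unit₂)
      rw [mul_inv_rev] at this
      simpa [unit₂] using this
    rw [hinv]
    constructor
    · refine ⟨ρ₁ * E.σ₁ (E.σ₂ (β⁻¹ : 𝔄ˣ)), mul_mem hρ₁ (hRJ _ hβ), ?_⟩
      rw [mul_neg, neg_neg, mul_assoc, mul_assoc, ← J_mul, J, mul_assoc]
    · refine ⟨E.σ₂ ((β⁻¹ : 𝔄ˣ) * ρ₁), hR₂ _ (mul_mem hβ hρ₁), ?_⟩
      rw [← neg_eq_iff_eq_neg.mpr E.Q₂_mul_Q₁, mul_neg, ← mul_assoc (E.σ₂ _), ← Q₂_mul]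
      simp only [neg_mul, mul_assoc]
  obtain ⟨⟨ρL, hρL, hXL⟩, ⟨ρR, hρR, hXR⟩⟩ := hLR
  obtain ⟨lam, hlam, hL⟩ : ∃ ρ ∈ R, axisL K A₁ A₂ = ρ * E.J := by
    have := hA.preAxisL_cong
    rw [axisL, hXL]
    rw [hXL] at this
    exact exists_pol_eq E.J_mul_self J_mul hRJ hρL this
  obtain ⟨rho, hrho, hR⟩ : ∃ ρ ∈ R, axisR K A₁ A₂ = ρ * E.J := by
    have := hA.preAxisR_cong
    rw [axisR, hXR]
    rw [hXR] at this
    exact exists_pol_eq E.J_mul_self J_mul hRJ hρR this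
  obtain ⟨B, hB, hBi, -, hB1⟩ := hA.exists_biax
  have hyR : -(axisL K A₁ A₂ * axisR K A₁ A₂) ∈ R := by
    rw [hL, hR, mul_assoc, ← mul_assoc E.J, J_mul, mul_assoc, J_mul_self]
    simpa using mul_mem hlam (hRJ _ hrho)
  have hBiR : ((B⁻¹ : 𝔄ˣ) : 𝔄) ∈ R := by
    rw [hBi]
    exact invSqrt_mem R hyR hA.biax_sq_cong.isNilpotent
  have hBR : (B : 𝔄) ∈ R := by
    have := inv_mem hB1.units_inv hBiR
    rwa [inv_inv] at this
  have hA' := hA.mul_biax_inv hB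
  have hL' := hA.axisL_mul_biax_inv (B := B)
  have hR' := hA.axisR_mul_biax_inv hB
  -- After division by ℬ both axes equal the original left axis, and this rotation carries it to J.
  obtain ⟨g, hg, hg1, hgP⟩ := exists_rotation hA.axisL_mul_self E.J_mul_self hA.axisL_cong
  have hgR : (g : 𝔄) ∈ R := by
    rw [hg, hL, J_mul, map_mul, map_mul, mul_assoc, show E.σ₁ (E.σ₂ E.J) = E.J by
      rw [σ₁_σ₂_apply, J_mul_self]; simp, J_mul_self]
    exact R.smul_mem (sub_mem (one_mem _) (by simpa using hRJ _ hlam)) _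
  have hgiR := inv_mem hg1 hgR
  have hA'' := hA'.conj hg1
  have hbase : E.IsBaseAxial (g * (A₁ * (B⁻¹ : 𝔄ˣ)) * (g⁻¹ : 𝔄ˣ))
      (g * (A₂ * (B⁻¹ : 𝔄ˣ)) * (g⁻¹ : 𝔄ˣ)) := by
    have e1 := hA'.map_axisL (conj K g)
    have e2 := hA'.map_axisR (conj K g)
    simp only [conj_apply] at e1 e2
    rw [hL', hgP] at e1
    rw [hR', hgP] at e2
    exact ⟨e1.symm, e2.symm⟩
  have h₁' : ∃ ρ ∈ R, g * (A₁ * (B⁻¹ : 𝔄ˣ)) * (g⁻¹ : 𝔄ˣ) = ρ * E.Q₁ :=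
    exists_conj_eq E.Q₁_mul hR₁
      (by simpa using exists_conj_eq E.Q₁_mul hR₁ h₁ (one_mem R) hBiR) hgR hgiR
  have h₂' : ∃ ρ ∈ R, g * (A₂ * (B⁻¹ : 𝔄ˣ)) * (g⁻¹ : 𝔄ˣ) = ρ * E.Q₂ :=
    exists_conj_eq E.Q₂_mul hR₂
      (by simpa using exists_conj_eq E.Q₂_mul hR₂ h₂ (one_mem R) hBiR) hgR hgiR
  obtain ⟨k, hk1, hkR, -, hk⟩ := exists_normalizer_of_isBaseAxial hR₁ hA'' hbase h₁' h₂'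
  refine ⟨B, k * g, hB, ?_, hBR, by simpa using mul_mem hkR hgR, hBiR, ?_⟩
  · simpa using hk1.mul hg1
  · simpa [mul_assoc] using hk

theorem IsPert.isBaseAxial_of_isNormal (hA : E.IsPert A₁ A₂) (h : E.IsNormal A₁ A₂) :
    E.IsBaseAxial A₁ A₂ :=
  hA.isBaseAxial_iff.mpr ((isNormal_iff A₁ A₂).mp h).1

/-- The normal form is unique up to elements that commute with the base. -/
theorem IsPert.commute_of_isNormal (hA : E.IsPert A₁ A₂) (h : E.IsNormal A₁ A₂) {g : 𝔄ˣ}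
    (hg : E.Cong g 1) (h' : E.IsNormal (g * A₁ * (g⁻¹ : 𝔄ˣ)) (g * A₂ * (g⁻¹ : 𝔄ˣ))) :
    Commute (g : 𝔄) E.Q₁ ∧ Commute (g : 𝔄) E.Q₂ := by
  -- Conjugation carries the axis of one pair to that of the other, and both are J. The same
  -- argument with the polarized average, which is Q₁ for both, follows; Q₂ = -Q₁J then settles the
  -- rest.
  have hJ : Commute (g : 𝔄) E.J := by
    have e1 := hA.map_axisL (FQ.conj K g)
    simp only [conj_apply] at e1
    rw [(hA.isBaseAxial_of_isNormal h).1, ((hA.conj hg).isBaseAxial_of_isNormal h').1,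
      Units.mul_inv_eq_iff_eq_mul] at e1
    exact e1
  have h1 : Commute (g : 𝔄) E.Q₁ := by
    have hD := hA.avg_cong
    have hD' := (hA.conj hg).avg_cong
    have e : E.avg (g * A₁ * (g⁻¹ : 𝔄ˣ)) (g * A₂ * (g⁻¹ : 𝔄ˣ))
        = FQ.conj K g (E.avg A₁ A₂) := by
      rw [conj_apply, avg, avg, mul_assoc _ _ E.J, hJ.units_inv_left.eq]
      simp only [mul_assoc, mul_add, add_mul, mul_smul_comm, smul_mul_assoc]
    have e1 := map_pol hD E.sq₁ (FQ.conj K g)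
    rw [← e, pol_eq_of_commute hD E.sq₁ ((isNormal_iff _ _).mp h).2,
      pol_eq_of_commute hD' E.sq₁ ((isNormal_iff _ _).mp h').2, conj_apply,
      Units.mul_inv_eq_iff_eq_mul] at e1
    exact e1
  refine ⟨h1, ?_⟩
  have : E.Q₂ = -(E.Q₁ * E.J) := by rw [J, ← mul_assoc, E.sq₁]; simp
  rw [this]
  exact (h1.mul_right hJ).neg_right

end Env

namespace Env

open MixedIndex

variable {K : Type u} {𝔄 : Type u} [Field K] [Ring 𝔄] [Algebra K 𝔄] {E : Env K 𝔄}

/-! ### Elimination of the lower indices `6, 7, 8` by conjugation -/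

theorem mul_sub_mul_mem_pow {n : ℕ} {h X Y : 𝔄} (hh : h ∈ E.I ^ n) (hXY : E.Cong X Y) :
    h * X - h * Y ∈ E.I ^ (n + 1) := by
  rw [← mul_sub, pow_succ]
  exact Submodule.mul_mem_mul hh hXY

theorem sub_mul_mul_mem_pow {n : ℕ} {h X Y : 𝔄} (hh : h ∈ E.I ^ n) (hXY : E.Cong X Y) :
    X * h - Y * h ∈ E.I ^ (n + 1) := by
  rw [← sub_mul, pow_succ']
  exact Submodule.mul_mem_mul hXY hh

/-- To leading order, conjugation by 1 + h adds the commutator of h with the base element. -/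
theorem conj_one_add_sub_mem_pow {n : ℕ} {h A Q : 𝔄} {g : 𝔄ˣ} (hg : (g : 𝔄) = 1 + h)
    (hh : h ∈ E.I ^ n) (hg1 : E.Cong g 1) (hAQ : E.Cong A Q) :
    g * A * (g⁻¹ : 𝔄ˣ) - A - (h * Q - Q * h) ∈ E.I ^ (n + 1) := by
  have h1 : g * A * (g⁻¹ : 𝔄ˣ) = A + (h * A - A * h) * (g⁻¹ : 𝔄ˣ) := by
    rw [Units.mul_inv_eq_iff_eq_mul, add_mul, Units.inv_mul_cancel_right, hg]
    noncomm_ring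
  have h2 : g * A * (g⁻¹ : 𝔄ˣ) - A - (h * Q - Q * h)
      = (h * (A * (g⁻¹ : 𝔄ˣ)) - h * Q)
        - (A * (h * (g⁻¹ : 𝔄ˣ) - h * 1) + (A * h - Q * h)) := by
    rw [h1]; noncomm_ring
  rw [h2]
  refine sub_mem (mul_sub_mul_mem_pow hh ?_) (add_mem (mul_mem_pow_left (Nat.succ_ne_zero n) _
    (mul_sub_mul_mem_pow hh hg1.units_inv)) (sub_mul_mul_mem_pow hh hAQ))
  simpa using hAQ.mul hg1.units_inv

variable [CharZero K] {A₁ A₂ : 𝔄}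

theorem IsPert.exists_conj_mem_pow (hA : E.IsPert A₁ A₂) {n : ℕ}
    (hr : ∀ i ∈ ({.i6, .i7, .i8} : Set MixedIndex), E.r A₁ A₂ i ∈ E.I ^ (n + 1)) :
    ∃ g : 𝔄ˣ, E.Cong g 1 ∧ ∀ i ∈ ({.i6, .i7, .i8} : Set MixedIndex),
      E.r (g * A₁ * (g⁻¹ : 𝔄ˣ)) (g * A₂ * (g⁻¹ : 𝔄ˣ)) i ∈ E.I ^ (n + 2) := by
  -- To leading order a changes by h - σ₁h and b by h - σ₂h. For this h these are -r₆ - r₇ - r₈ and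
  -- -r₆ - r₇ + r₈, which cancel the components 6, 7, 8.
  obtain ⟨h, hh⟩ : ∃ h, h = -((2⁻¹ : K) • E.r A₁ A₂ .i6) - E.r A₁ A₂ .i7 := ⟨_, rfl⟩
  have hI : h ∈ E.I := by
    rw [hh]
    exact sub_mem (neg_mem (E.I.smul_mem _ (hA.r_mem _))) (hA.r_mem _)
  have hn : h ∈ E.I ^ (n + 1) := by
    rw [hh]
    exact sub_mem (neg_mem (Submodule.smul_mem _ _ (hr _ (by simp)))) (hr _ (by simp))
  have hc : E.Cong (1 + h) 1 := by simpa [Cong] using hI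
  obtain ⟨g, hg⟩ := hc.isUnit
  rw [← hg] at hc
  refine ⟨g, hc, fun i hi => ?_⟩
  have e1 := mul_mem_pow_right (Nat.succ_ne_zero (n + 1)) (-E.Q₁)
    (conj_one_add_sub_mem_pow hg hn hc (show E.Cong A₁ E.Q₁ from hA.1))
  have e2 := mul_mem_pow_right (Nat.succ_ne_zero (n + 1)) (-E.Q₂)
    (conj_one_add_sub_mem_pow hg hn hc (show E.Cong A₂ E.Q₂ from hA.2))
  set A₁' := g * A₁ * (g⁻¹ : 𝔄ˣ)
  set A₂' := g * A₂ * (g⁻¹ : 𝔄ˣ)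
  have f1 : E.fst A₁' = E.fst A₁ + (h - E.σ₁ h)
      + (A₁' - A₁ - (h * E.Q₁ - E.Q₁ * h)) * -E.Q₁ := by
    rw [Q₁_mul, fst, fst]
    have : (A₁' - A₁ - (h * E.Q₁ - E.σ₁ h * E.Q₁)) * -E.Q₁
      = -(A₁' * E.Q₁) + A₁ * E.Q₁ + h * (E.Q₁ * E.Q₁) - E.σ₁ h * (E.Q₁ * E.Q₁) := by noncomm_ring
    rw [this, E.sq₁]; noncomm_ring
  have f2 : E.snd A₂' = E.snd A₂ + (h - E.σ₂ h)
      + (A₂' - A₂ - (h * E.Q₂ - E.Q₂ * h)) * -E.Q₂ := by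
    rw [Q₂_mul, snd, snd]
    have : (A₂' - A₂ - (h * E.Q₂ - E.σ₂ h * E.Q₂)) * -E.Q₂
      = -(A₂' * E.Q₂) + A₂ * E.Q₂ + h * (E.Q₂ * E.Q₂) - E.σ₂ h * (E.Q₂ * E.Q₂) := by noncomm_ring
    rw [this, E.sq₂]; noncomm_ring
  rw [r_eq_mix, f1, f2, mix_add, mix_add]
  have h0 : E.mix (E.fst A₁) (E.snd A₂) i + E.mix (h - E.σ₁ h) (h - E.σ₂ h) i = 0 := by
    rw [r_eq_mix, r_eq_mix] at hh
    have h1 : E.σ₁ h = (2⁻¹ : K) • E.mix (E.fst A₁) (E.snd A₂) .i6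
        + E.mix (E.fst A₁) (E.snd A₂) .i8 := by
      rw [hh]; simp [σ₁_mix, sign₁, swap]
    have h2 : E.σ₂ h = (2⁻¹ : K) • E.mix (E.fst A₁) (E.snd A₂) .i6
        - E.mix (E.fst A₁) (E.snd A₂) .i8 := by
      rw [hh]; simp [σ₂_mix, sign₂, swap]
    rw [h1, h2, hh]
    have s1 := E.σ₁_mix (E.fst A₁) (E.snd A₂)
    have s2 := E.σ₂_mix (E.fst A₁) (E.snd A₂)
    generalize E.mix (E.fst A₁) (E.snd A₂) = x at s1 s2 ⊢
    rcases hi with rfl | rfl | rfl <;> simp [mix, s1, s2, sign₁, sign₂, swap] <;> module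
  rw [h0, zero_add]
  exact E.mix_mem (M := E.I ^ (n + 2))
    (fun x hx => by
      rw [σ₁_apply]
      exact neg_mem (mul_mem_pow_right (by simp) _ (mul_mem_pow_left (by simp) _ hx)))
    (fun x hx => by
      rw [σ₂_apply]
      exact neg_mem (mul_mem_pow_right (by simp) _ (mul_mem_pow_left (by simp) _ hx))) e1 e2 i

theorem IsPert.exists_conj_r_eq_zero (hA : E.IsPert A₁ A₂) :
    ∃ g : 𝔄ˣ, E.Cong g 1 ∧ ∀ i ∈ ({.i6, .i7, .i8} : Set MixedIndex),
      E.r (g * A₁ * (g⁻¹ : 𝔄ˣ)) (g * A₂ * (g⁻¹ : 𝔄ˣ)) i = 0 := by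
  have key : ∀ n : ℕ, ∃ g : 𝔄ˣ, E.Cong g 1 ∧ ∀ i ∈ ({.i6, .i7, .i8} : Set MixedIndex),
      E.r (g * A₁ * (g⁻¹ : 𝔄ˣ)) (g * A₂ * (g⁻¹ : 𝔄ˣ)) i ∈ E.I ^ (n + 1) := by
    intro n
    induction n with
    | zero => exact ⟨1, Cong.refl 1, fun i _ => by simpa using hA.r_mem i⟩
    | succ n ih =>
      obtain ⟨g, hg, h⟩ := ih
      obtain ⟨k, hk, h'⟩ := (hA.conj hg).exists_conj_mem_pow h
      refine ⟨k * g, by simpa using hk.mul hg, fun i hi => ?_⟩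
      simpa [mul_assoc] using h' i hi
  obtain ⟨N, hN⟩ := E.nilpotent
  obtain ⟨g, hg, h⟩ := key N
  refine ⟨g, hg, fun i hi => ?_⟩
  simpa [pow_eq_bot_of_le hN (Nat.le_succ N)] using h i hi

/-! ### Evaluation of words and of power series -/

variable (E) in
/-- The value of a word in the components of the mixed base. -/
def word (A₁ A₂ : 𝔄) (w : List MixedIndex) : 𝔄 := (w.map (E.r A₁ A₂)).prod

variable (E) in
/-- The value of a noncommutative power series in the components of the mixed base. -/
def val (A₁ A₂ : 𝔄) (p : List MixedIndex → K) : 𝔄 := ∑ᶠ w, p w • E.word A₁ A₂ w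

/-- The words that are shorter than `N`. -/
def _root_.FQ.wordsLT (N : ℕ) : Finset (List MixedIndex) :=
  (List.finite_length_lt MixedIndex N).toFinset

theorem _root_.FQ.mem_wordsLT {N : ℕ} {w : List MixedIndex} : w ∈ wordsLT N ↔ w.length < N := by
  simp [wordsLT]

theorem IsPert.word_mem (hA : E.IsPert A₁ A₂) (w : List MixedIndex) :
    E.word A₁ A₂ w ∈ E.I ^ w.length := by
  induction w with
  | nil => simp [word, Submodule.one_le.mp le_rfl]
  | cons i w ih =>
    rw [List.length_cons, pow_succ', word, List.map_cons, List.prod_cons]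
    exact Submodule.mul_mem_mul (hA.r_mem i) ih

theorem IsPert.word_eq_zero (hA : E.IsPert A₁ A₂) {N : ℕ} (hN : E.I ^ N = ⊥)
    {w : List MixedIndex} (hw : N ≤ w.length) : E.word A₁ A₂ w = 0 := by
  simpa [pow_eq_bot_of_le hN hw] using hA.word_mem w

omit [CharZero K] in
theorem word_eq_zero_of_notMem {T : Set MixedIndex} (hT : ∀ i ∉ T, E.r A₁ A₂ i = 0)
    {w : List MixedIndex} (hw : w ∉ words T) : E.word A₁ A₂ w = 0 := by
  simp only [words, Set.mem_ofPred_eq, not_forall] at hw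
  obtain ⟨i, hi, hiT⟩ := hw
  exact List.prod_eq_zero (List.mem_map.mpr ⟨i, hi, hT i hiT⟩)

theorem IsPert.val_eq_sum (hA : E.IsPert A₁ A₂) {N : ℕ} (hN : E.I ^ N = ⊥)
    (p : List MixedIndex → K) : E.val A₁ A₂ p = ∑ w ∈ wordsLT N, p w • E.word A₁ A₂ w := by
  apply finsum_eq_sum_of_support_subset
  intro w hw
  by_contra hN'
  simp only [Finset.mem_coe, mem_wordsLT, not_lt] at hN'
  exact hw (by simp [hA.word_eq_zero hN hN'])

omit [CharZero K] in
theorem val_congr {T : Set MixedIndex} (hT : ∀ i ∉ T, E.r A₁ A₂ i = 0)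
    {p q : List MixedIndex → K} (h : ∀ w ∈ words T, p w = q w) :
    E.val A₁ A₂ p = E.val A₁ A₂ q := by
  refine finsum_congr fun w => ?_
  by_cases hw : w ∈ words T
  · rw [h w hw]
  · rw [word_eq_zero_of_notMem hT hw, smul_zero, smul_zero]

theorem map_word {𝔅 : Type u} [Ring 𝔅] [Algebra K 𝔅] (E' : Env K 𝔅) (φ : 𝔄 →ₐ[K] 𝔅)
    (h₁ : φ E.Q₁ = E'.Q₁) (h₂ : φ E.Q₂ = E'.Q₂) (w : List MixedIndex) :
    φ (E.word A₁ A₂ w) = E'.word (φ A₁) (φ A₂) w := by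
  rw [word, word, map_list_prod, List.map_map]
  congr 1
  exact List.map_congr_left fun i _ => E.map_r E' φ h₁ h₂ A₁ A₂ i

omit [CharZero K] in
theorem map_Qc {𝔅 : Type u} [Ring 𝔅] [Algebra K 𝔅] (E' : Env K 𝔅) (φ : 𝔄 →ₐ[K] 𝔅)
    (h₁ : φ E.Q₁ = E'.Q₁) (h₂ : φ E.Q₂ = E'.Q₂) (s : Comp) : φ (E.Qc s) = E'.Qc s := by
  cases s <;> simp [Qc, h₁, h₂]

omit [CharZero K] in
variable (E) in
theorem isUnit_Qc (s : Comp) : IsUnit (E.Qc s) := by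
  cases s
  exacts [isUnit_one, E.unit₁.isUnit, E.unit₂.isUnit, (E.unit₁ * E.unit₂).isUnit]

theorem word_conj {g : 𝔄ˣ} (h₁ : Commute (g : 𝔄) E.Q₁) (h₂ : Commute (g : 𝔄) E.Q₂)
    (w : List MixedIndex) :
    E.word (g * A₁ * (g⁻¹ : 𝔄ˣ)) (g * A₂ * (g⁻¹ : 𝔄ˣ)) w
      = g * E.word A₁ A₂ w * (g⁻¹ : 𝔄ˣ) := by
  have := map_word (E := E) (A₁ := A₁) (A₂ := A₂) E (conj K g) (by simp [h₁.eq]) (by simp [h₂.eq]) w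
  simpa using this.symm

omit [CharZero K] in
theorem commute_Qc {g : 𝔄} (h₁ : Commute g E.Q₁) (h₂ : Commute g E.Q₂) (s : Comp) :
    Commute g (E.Qc s) := by
  cases s
  exacts [Commute.one_right _, h₁, h₂, h₁.mul_right h₂]

end Env

/-! ### The universal environment of a given order of nilpotency -/

section Universal

variable (K : Type u) [Field K] (N : ℕ)

/-- Two expressions in `Q₁, Q₂, A₁, A₂` are identified if they agree in all environments with
`I ^ N = 0`. -/
def UniRel (x y : FreeAlgebra K (Fin 4)) : Prop :=
  ∀ (𝔄 : Type u) [Ring 𝔄] [Algebra K 𝔄] (E : Env K 𝔄) (A₁ A₂ : 𝔄), E.IsPert A₁ A₂ →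
    E.I ^ N = ⊥ → FreeAlgebra.lift K ![E.Q₁, E.Q₂, A₁, A₂] x
      = FreeAlgebra.lift K ![E.Q₁, E.Q₂, A₁, A₂] y

/-- The algebra of the universal environment with `I ^ N = 0`. -/
abbrev Uni : Type u := RingQuot (UniRel K N)

/-- The canonical map from expressions to the universal environment. -/
def Uni.mk : FreeAlgebra K (Fin 4) →ₐ[K] Uni K N := RingQuot.mkAlgHom K (UniRel K N)

variable {K N}

theorem Uni.mk_eq {x y : FreeAlgebra K (Fin 4)} (h : UniRel K N x y) :
    Uni.mk K N x = Uni.mk K N y :=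
  RingQuot.mkAlgHom_rel K h

/-- The universal property. -/
def Uni.lift {𝔄 : Type u} [Ring 𝔄] [Algebra K 𝔄] {E : Env K 𝔄} {A₁ A₂ : 𝔄}
    (hA : E.IsPert A₁ A₂) (hN : E.I ^ N = ⊥) : Uni K N →ₐ[K] 𝔄 :=
  RingQuot.liftAlgHom K ⟨FreeAlgebra.lift K ![E.Q₁, E.Q₂, A₁, A₂], fun _ _ h => h 𝔄 E A₁ A₂ hA hN⟩

@[simp]
theorem Uni.lift_mk {𝔄 : Type u} [Ring 𝔄] [Algebra K 𝔄] {E : Env K 𝔄} {A₁ A₂ : 𝔄}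
    (hA : E.IsPert A₁ A₂) (hN : E.I ^ N = ⊥) (x : FreeAlgebra K (Fin 4)) :
    Uni.lift hA hN (Uni.mk K N x) = FreeAlgebra.lift K ![E.Q₁, E.Q₂, A₁, A₂] x :=
  RingQuot.liftAlgHom_mkAlgHom_apply _ _ _ _

/-- The defining relation is agreement in all environments, so these maps separate points. -/
theorem Uni.ext {x y : Uni K N} (h : ∀ (𝔄 : Type u) [Ring 𝔄] [Algebra K 𝔄] (E : Env K 𝔄)
    (A₁ A₂ : 𝔄) (hA : E.IsPert A₁ A₂) (hN : E.I ^ N = ⊥), Uni.lift hA hN x = Uni.lift hA hN y) :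
    x = y := by
  obtain ⟨x, rfl⟩ := RingQuot.mkAlgHom_surjective K (UniRel K N) x
  obtain ⟨y, rfl⟩ := RingQuot.mkAlgHom_surjective K (UniRel K N) y
  refine Uni.mk_eq fun 𝔄 _ _ E A₁ A₂ hA hN => ?_
  rw [← Uni.lift_mk hA hN, ← Uni.lift_mk hA hN]
  exact h 𝔄 E A₁ A₂ hA hN

variable (K N)

/-- The infinitesimal elements of the universal environment. -/
def Uni.ideal : Submodule K (Uni K N) where
  carrier := {x | ∀ (𝔄 : Type u) [Ring 𝔄] [Algebra K 𝔄] (E : Env K 𝔄) (A₁ A₂ : 𝔄)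
    (hA : E.IsPert A₁ A₂) (hN : E.I ^ N = ⊥), Uni.lift hA hN x ∈ E.I}
  add_mem' := fun hx hy 𝔄 _ _ E A₁ A₂ hA hN => by
    rw [map_add]; exact add_mem (hx 𝔄 E A₁ A₂ hA hN) (hy 𝔄 E A₁ A₂ hA hN)
  zero_mem' := fun 𝔄 _ _ E A₁ A₂ hA hN => by rw [map_zero]; exact zero_mem _
  smul_mem' := fun c x hx 𝔄 _ _ E A₁ A₂ hA hN => by
    rw [map_smul]; exact E.I.smul_mem c (hx 𝔄 E A₁ A₂ hA hN)

theorem Uni.ideal_pow : Uni.ideal K N ^ N = ⊥ := by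
  rw [Submodule.eq_bot_iff]
  intro x hx
  refine Uni.ext fun 𝔄 _ _ E A₁ A₂ hA hN => ?_
  rw [map_zero]
  have h1 := Submodule.mem_map_of_mem (f := (Uni.lift hA hN).toLinearMap) hx
  rw [Submodule.map_pow] at h1
  have h2 := pow_le_pow_left' (Submodule.map_le_iff_le_comap.mpr
    (fun y hy => hy 𝔄 E A₁ A₂ hA hN : Uni.ideal K N ≤
      E.I.comap (Uni.lift hA hN).toLinearMap)) N h1
  simpa [hN] using h2

/-- The universal environment with `I ^ N = 0`. -/
def Uni.env : Env K (Uni K N) where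
  Q₁ := Uni.mk K N (FreeAlgebra.ι K 0)
  Q₂ := Uni.mk K N (FreeAlgebra.ι K 1)
  sq₁ := Uni.ext fun 𝔄 _ _ E A₁ A₂ hA hN => by simp [E.sq₁]
  sq₂ := Uni.ext fun 𝔄 _ _ E A₁ A₂ hA hN => by simp [E.sq₂]
  anticomm := Uni.ext fun 𝔄 _ _ E A₁ A₂ hA hN => by simp [E.anticomm]
  I := Uni.ideal K N
  mul_mem_left := fun a x hx 𝔄 _ _ E A₁ A₂ hA hN => by
    rw [map_mul]; exact E.mul_mem_left _ _ (hx 𝔄 E A₁ A₂ hA hN)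
  mul_mem_right := fun a x hx 𝔄 _ _ E A₁ A₂ hA hN => by
    rw [map_mul]; exact E.mul_mem_right _ _ (hx 𝔄 E A₁ A₂ hA hN)
  nilpotent := ⟨N, Uni.ideal_pow K N⟩

/-- The universal perturbation of `Q₁`. -/
def Uni.A₁ : Uni K N := Uni.mk K N (FreeAlgebra.ι K 2)

/-- The universal perturbation of `Q₂`. -/
def Uni.A₂ : Uni K N := Uni.mk K N (FreeAlgebra.ι K 3)

theorem Uni.isPert : (Uni.env K N).IsPert (Uni.A₁ K N) (Uni.A₂ K N) :=
  ⟨fun 𝔄 _ _ E A₁ A₂ hA hN => by simpa [Uni.A₁, Uni.env] using hA.1,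
    fun 𝔄 _ _ E A₁ A₂ hA hN => by simpa [Uni.A₂, Uni.env] using hA.2⟩

end Universal

/-! ### An environment in which the words are linearly independent -/

namespace MixedIndex

theorem swap_swap (i : MixedIndex) : swap (swap i) = i := by cases i <;> rfl

theorem sign₁_swap (i : MixedIndex) : sign₁ (swap i) = sign₁ i := by cases i <;> rfl

theorem sign₂_swap (i : MixedIndex) : sign₂ (swap i) = sign₂ i := by cases i <;> rfl

theorem sign₁_mul_self (i : MixedIndex) : sign₁ i * sign₁ i = 1 := by cases i <;> rfl

theorem sign₂_mul_self (i : MixedIndex) : sign₂ i * sign₂ i = 1 := by cases i <;> rfl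

end MixedIndex

open MixedIndex

namespace Env

variable {K : Type u} [Field K] [CharZero K] {𝔄 : Type u} [Ring 𝔄] [Algebra K 𝔄] (E : Env K 𝔄)

/-- The components of a perturbation in the mixed base can be prescribed. -/
theorem exists_isPert_r_eq {x : MixedIndex → 𝔄} (hx : ∀ i, x i ∈ E.I)
    (h₁ : ∀ i, E.Q₁ * x i = sign₁ i • (x (swap i) * E.Q₁))
    (h₂ : ∀ i, E.Q₂ * x i = sign₂ i • (x (swap i) * E.Q₂)) :
    ∃ A₁ A₂, E.IsPert A₁ A₂ ∧ E.r A₁ A₂ = x := by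
  have hσ₁ : ∀ i, E.σ₁ (x i) = sign₁ i • x (swap i) := fun i => by
    rw [σ₁_apply, h₁, smul_mul_assoc, mul_assoc, E.sq₁]; simp
  have hσ₂ : ∀ i, E.σ₂ (x i) = sign₂ i • x (swap i) := fun i => by
    rw [σ₂_apply, h₂, smul_mul_assoc, mul_assoc, E.sq₂]; simp
  refine ⟨(1 + (x .i1 + x .i2 + x .i3 + x .i4 + x .i5 + x .i6 + x .i7 + x .i8)) * E.Q₁,
    (1 + (-x .i1 + x .i2 + x .i3 - x .i4 - x .i5 + x .i6 + x .i7 - x .i8)) * E.Q₂,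
    ⟨?_, ?_⟩, ?_⟩
  · rw [add_mul, one_mul, add_sub_cancel_left]
    refine E.mul_mem_right _ _ ?_
    repeat' first | apply hx | apply add_mem
  · rw [add_mul, one_mul, add_sub_cancel_left]
    refine E.mul_mem_right _ _ ?_
    repeat' first | apply hx | apply add_mem | apply sub_mem | apply neg_mem
  · ext1 i
    rw [r_eq_mix, fst_one_add_mul, snd_one_add_mul, E.mix_eq hσ₁ hσ₂]

end Env

section Model

variable (K : Type u) [Field K]

/-- The quaternions over `K`. -/
abbrev Quat : Type u := QuaternionAlgebra K (-1) 0 (-1)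

/-- The space on which the model environment acts. -/
abbrev ModelSpace : Type u := List MixedIndex → Quat K

/-- The operators by which `Q₁` and `Q₂` act. -/
def modelQ (sgn : MixedIndex → ℤ) (q : Quat K) : Module.End K (ModelSpace K) where
  toFun f w := (w.map sgn).prod • (q * f (w.map swap))
  map_add' f g := by ext1 w; simp [mul_add]
  map_smul' c f := by ext1 w; simp

open Classical in
/-- The operators by which the components in the mixed base act. -/
def modelR (N : ℕ) (i : MixedIndex) : Module.End K (ModelSpace K) where
  toFun f
    | [] => 0
    | j :: w => if j = i ∧ w.length < N then f w else 0
  map_add' f g := by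
    ext1 w
    cases w <;> simp
    split_ifs <;> simp
  map_smul' c f := by
    ext1 w
    cases w <;> simp

variable {K}

theorem modelQ_mul_modelQ {s t : MixedIndex → ℤ} (ht : ∀ i, t (swap i) = t i)
    (p q : Quat K) (f : ModelSpace K) (w : List MixedIndex) :
    modelQ K s p (modelQ K t q f) w = ((w.map s).prod * (w.map t).prod) • (p * q * f w) := by
  have h1 : (w.map swap).map swap = w := by
    rw [List.map_map, show swap ∘ swap = id from funext swap_swap, List.map_id]
  have h2 : (w.map swap).map t = w.map t := by
    rw [List.map_map, show t ∘ swap = t from funext ht]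
  simp only [modelQ, LinearMap.coe_mk, AddHom.coe_mk, h1, h2, mul_smul, mul_smul_comm, mul_assoc]

theorem modelQ_mul_self {s : MixedIndex → ℤ} (hs : ∀ i, s (swap i) = s i)
    (hs' : ∀ i, s i * s i = 1) {q : Quat K} (hq : q * q = -1) :
    modelQ K s q * modelQ K s q = -1 := by
  ext1 f
  ext1 w
  have h : ∀ w : List MixedIndex, (w.map s).prod * (w.map s).prod = 1 := fun w => by
    induction w with
    | nil => simp
    | cons i w ih =>
      rw [List.map_cons, List.prod_cons, mul_mul_mul_comm, ih, hs', one_mul]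
  change modelQ K s q (modelQ K s q f) w = _
  rw [modelQ_mul_modelQ hs, h, hq]
  simp

/-- The signed swaps of letters commute; the quaternion factor supplies the sign. -/
theorem modelQ_anticomm {s t : MixedIndex → ℤ} (hs : ∀ i, s (swap i) = s i)
    (ht : ∀ i, t (swap i) = t i) {p q : Quat K} (hpq : p * q = -(q * p)) :
    modelQ K s p * modelQ K t q = -(modelQ K t q * modelQ K s p) := by
  ext1 f
  ext1 w
  change modelQ K s p (modelQ K t q f) w = -(modelQ K t q (modelQ K s p f) w)
  rw [modelQ_mul_modelQ hs, modelQ_mul_modelQ ht, hpq, mul_comm]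
  simp

theorem modelQ_mul_modelR {s : MixedIndex → ℤ} (hs : ∀ i, s (swap i) = s i) (q : Quat K)
    (N : ℕ) (i : MixedIndex) :
    modelQ K s q * modelR K N i = s i • (modelR K N (swap i) * modelQ K s q) := by
  ext1 f
  ext1 w
  change modelQ K s q (modelR K N i f) w = s i • modelR K N (swap i) (modelQ K s q f) w
  cases w with
  | nil => simp [modelQ, modelR]
  | cons j w =>
    simp only [modelQ, modelR, LinearMap.coe_mk, AddHom.coe_mk, List.map_cons, List.prod_cons,
      List.length_map]
    by_cases h : j = swap i ∧ w.length < N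
    · rw [if_pos h, if_pos ⟨by rw [h.1, swap_swap], by simpa using h.2⟩, h.1, hs, mul_smul]
    · rw [if_neg h, if_neg fun h' => h ⟨by rw [← h'.1, swap_swap], by simpa using h'.2⟩, mul_zero, smul_zero,
        smul_zero]

variable (K)

/-- The filtration of the model space by word length. -/
def modelFil (k : ℕ) : Submodule K (ModelSpace K) where
  carrier := {f | ∀ w, w.length < k → f w = 0}
  add_mem' hf hg w hw := by simp [hf w hw, hg w hw]
  zero_mem' w hw := rfl
  smul_mem' c f hf w hw := by simp [hf w hw]

/-- The algebra of the model environment. -/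
def modelAlg : Subalgebra K (Module.End K (ModelSpace K)) where
  carrier := {T | ∀ k, ∀ f ∈ modelFil K k, T f ∈ modelFil K k}
  add_mem' hS hT k f hf := add_mem (hS k f hf) (hT k f hf)
  mul_mem' hS hT k f hf := hS k _ (hT k f hf)
  algebraMap_mem' c k f hf := by
    rw [Module.algebraMap_end_apply]
    exact Submodule.smul_mem _ c hf

/-- The infinitesimal elements of the model environment. -/
def modelIdeal (N : ℕ) : Submodule K (modelAlg K) where
  carrier := {T | (∀ k, ∀ f ∈ modelFil K k, T.1 f ∈ modelFil K (k + 1)) ∧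
    ∀ f ∈ modelFil K N, T.1 f = 0}
  add_mem' hS hT := ⟨fun k f hf => add_mem (hS.1 k f hf) (hT.1 k f hf), fun f hf => by
    simp [hS.2 f hf, hT.2 f hf]⟩
  zero_mem' := ⟨fun _ _ _ => zero_mem _, fun _ _ => rfl⟩
  smul_mem' c _ hT := ⟨fun k f hf => Submodule.smul_mem _ c (hT.1 k f hf), fun f hf => by
    simp [hT.2 f hf]⟩

/-- The operators that raise the filtration by `n`. -/
def modelRaise (n : ℕ) : Submodule K (modelAlg K) where
  carrier := {T | ∀ k, ∀ f ∈ modelFil K k, T.1 f ∈ modelFil K (k + n)}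
  add_mem' hS hT := fun k f hf => add_mem (hS k f hf) (hT k f hf)
  zero_mem' := fun _ _ _ => zero_mem _
  smul_mem' c _ hT := fun k f hf => Submodule.smul_mem _ c (hT k f hf)

theorem modelIdeal_pow_le (N n : ℕ) : modelIdeal K N ^ n ≤ modelRaise K n := by
  induction n with
  | zero =>
    intro T _ k f hf
    exact T.2 k f hf
  | succ n ih =>
    rw [pow_succ', Submodule.mul_le]
    intro S hS T hT k f hf
    exact hS.1 _ _ (ih hT k f hf)

/-- N factors raise every function to level N of the filtration, which one more factor annihilates.
-/
theorem modelIdeal_pow (N : ℕ) : modelIdeal K N ^ (N + 1) = ⊥ := by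
  rw [eq_bot_iff, pow_succ', Submodule.mul_le]
  intro S hS T hT
  rw [Submodule.mem_bot]
  ext1
  refine LinearMap.ext fun f => ?_
  have := modelIdeal_pow_le K N N hT 0 f (fun w hw => absurd hw (Nat.not_lt_zero _))
  rw [zero_add] at this
  exact hS.2 _ this

theorem modelQ_mem (s : MixedIndex → ℤ) (q : Quat K) : modelQ K s q ∈ modelAlg K := by
  intro k f hf w hw
  simp [modelQ, hf (w.map swap) (by simpa using hw)]

theorem modelR_raise (N : ℕ) (i : MixedIndex) (k : ℕ) (f) (hf : f ∈ modelFil K k) :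
    modelR K N i f ∈ modelFil K (k + 1) := by
  intro w hw
  cases w with
  | nil => rfl
  | cons j w => simp [modelR, hf w (by simpa using hw)]

theorem modelR_mem (N : ℕ) (i : MixedIndex) : modelR K N i ∈ modelAlg K := by
  intro k f hf w hw
  exact modelR_raise K N i k f hf w (hw.trans (Nat.lt_succ_self k))

theorem modelR_mem_ideal (N : ℕ) (i : MixedIndex) :
    (⟨modelR K N i, modelR_mem K N i⟩ : modelAlg K) ∈ modelIdeal K N := by
  refine ⟨fun k f hf => modelR_raise K N i k f hf, fun f hf => ?_⟩
  ext1 w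
  cases w with
  | nil => rfl
  | cons j w =>
    simp only [modelR, LinearMap.coe_mk, AddHom.coe_mk]
    split_ifs with h
    · rw [hf w h.2]; rfl
    · rfl

/-- The quaternion `i`. -/
def quaternionI : Quat K := ⟨0, 1, 0, 0⟩

/-- The quaternion `j`. -/
def quaternionJ : Quat K := ⟨0, 0, 1, 0⟩

theorem quaternionI_mul_self : quaternionI K * quaternionI K = -1 := by
  ext <;> simp [quaternionI]

theorem quaternionJ_mul_self : quaternionJ K * quaternionJ K = -1 := by
  ext <;> simp [quaternionJ]

theorem quaternion_anticomm :
    quaternionI K * quaternionJ K = -(quaternionJ K * quaternionI K) := by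
  ext <;> simp [quaternionI, quaternionJ]

/-- The model environment. -/
def modelEnv (N : ℕ) : Env K (modelAlg K) where
  Q₁ := ⟨modelQ K sign₁ (quaternionI K), modelQ_mem K _ _⟩
  Q₂ := ⟨modelQ K sign₂ (quaternionJ K), modelQ_mem K _ _⟩
  sq₁ := Subtype.ext (modelQ_mul_self sign₁_swap sign₁_mul_self (quaternionI_mul_self K))
  sq₂ := Subtype.ext (modelQ_mul_self sign₂_swap sign₂_mul_self (quaternionJ_mul_self K))
  anticomm := Subtype.ext (modelQ_anticomm sign₁_swap sign₂_swap (quaternion_anticomm K))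
  I := modelIdeal K N
  mul_mem_left S T hT := ⟨fun k f hf => S.2 _ _ (hT.1 k f hf), fun f hf => by
    change S.1 (T.1 f) = 0
    rw [hT.2 f hf, map_zero]⟩
  mul_mem_right S T hT := ⟨fun k f hf => hT.1 _ _ (S.2 k f hf), fun f hf => hT.2 _ (S.2 N f hf)⟩
  nilpotent := ⟨N + 1, modelIdeal_pow K N⟩

open Classical in
/-- The components of the generic perturbation with lower indices in `T`. -/
def modelX (T : Set MixedIndex) (N : ℕ) (i : MixedIndex) : modelAlg K :=
  if i ∈ T then ⟨modelR K N i, modelR_mem K N i⟩ else 0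

-- Each operator prepends its letter, so a word with letters in T sends the delta function at the
-- empty word to the delta function at itself, as seen on words of length at most N. This is the
-- linear independence of words.
open Classical in
theorem modelX_prod_apply (T : Set MixedIndex) (N : ℕ) (u w : List MixedIndex)
    (hw : w.length ≤ N) :
    ((u.map (modelX K T N)).prod.1 (Pi.single [] 1) : ModelSpace K) w
      = if u = w ∧ u ∈ words T then 1 else 0 := by
  induction u generalizing w with
  | nil =>
    cases w <;> simp [words]
  | cons i u ih =>
    rw [List.map_cons, List.prod_cons]
    change (modelX K T N i).1 ((u.map (modelX K T N)).prod.1 (Pi.single [] 1)) w = _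
    by_cases hi : i ∈ T
    · rw [modelX, if_pos hi]
      cases w with
      | nil => simp [modelR]
      | cons j w =>
        have hw' : w.length < N := by simpa using hw
        simp only [modelR, LinearMap.coe_mk, AddHom.coe_mk, hw', and_true, ih w hw'.le]
        by_cases hij : i = j
        · subst hij
          simp only [true_and, if_true, List.cons.injEq]
          congr 1
          simp [words, hi]
        · simp [hij, Ne.symm hij]
    · rw [modelX, if_neg hi]
      have : i :: u ∉ words T := fun h => hi (h i (by simp))
      simp [this]

variable [CharZero K]

open Classical in
/-- The coefficients of words with letters in `T` can be read off from the values. -/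
theorem exists_separating_env (T : Set MixedIndex) (hT : ∀ i, swap i ∈ T ↔ i ∈ T) (N : ℕ) :
    ∃ (𝔄 : Type u) (_ : Ring 𝔄) (_ : Algebra K 𝔄) (E : Env K 𝔄) (A₁ A₂ : 𝔄),
      E.IsPert A₁ A₂ ∧ E.I ^ (N + 1) = ⊥ ∧ (∀ i ∉ T, E.r A₁ A₂ i = 0) ∧
      ∀ p q : List MixedIndex → K, E.val A₁ A₂ p = E.val A₁ A₂ q →
        ∀ w ∈ words T, w.length ≤ N → p w = q w := by
  set E := modelEnv K N
  set x := modelX K T N with hx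
  have hxI : ∀ i, x i ∈ E.I := fun i => by
    rw [hx, modelX]
    split_ifs
    exacts [modelR_mem_ideal K N i, zero_mem _]
  have hQ₁ : ∀ i, E.Q₁ * x i = sign₁ i • (x (swap i) * E.Q₁) := fun i => by
    by_cases hi : i ∈ T
    · simp only [hx, modelX, if_pos hi, if_pos ((hT i).mpr hi)]
      exact Subtype.ext (modelQ_mul_modelR sign₁_swap _ N i)
    · simp [hx, modelX, hi, hT i]
  have hQ₂ : ∀ i, E.Q₂ * x i = sign₂ i • (x (swap i) * E.Q₂) := fun i => by
    by_cases hi : i ∈ T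
    · simp only [hx, modelX, if_pos hi, if_pos ((hT i).mpr hi)]
      exact Subtype.ext (modelQ_mul_modelR sign₂_swap _ N i)
    · simp [hx, modelX, hi, hT i]
  obtain ⟨A₁, A₂, hA, hr⟩ := E.exists_isPert_r_eq hxI hQ₁ hQ₂
  have hval : ∀ p : List MixedIndex → K, ∀ w ∈ words T, w.length ≤ N →
      ((E.val A₁ A₂ p).1 (Pi.single [] 1) : ModelSpace K) w
        = p w • 1 := fun p w hw hwN => by
    rw [hA.val_eq_sum (modelIdeal_pow K N)]
    have : ∀ u ∈ wordsLT (N + 1),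
        ((p u • E.word A₁ A₂ u).1 (Pi.single [] 1) : ModelSpace K) w
          = if u = w then p w • 1 else 0 := fun u _ => by
      change p u • ((E.word A₁ A₂ u).1 (Pi.single [] 1) :
        ModelSpace K) w = _
      rw [Env.word, hr, modelX_prod_apply K T N u w hwN]
      by_cases h : u = w
      · subst h; simp [hw]
      · simp [h]
    rw [← Subalgebra.coe_val, map_sum, LinearMap.sum_apply, Finset.sum_apply]
    refine (Finset.sum_congr rfl this).trans ?_
    rw [Finset.sum_ite_eq', if_pos]
    rw [mem_wordsLT]; omega
  refine ⟨modelAlg K, inferInstance, inferInstance, E, A₁, A₂, hA,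
    modelIdeal_pow K N, fun i hi => by rw [hr, hx, modelX, if_neg hi], fun p q hpq w hw hwN => ?_⟩
  have h := hval p w hw hwN
  rw [hpq, hval q w hw hwN] at h
  exact (smul_left_injective K (one_ne_zero (α := Quat K)) h).symm

end Model

/-! ### Pulling words back from the normal form -/

open MixedIndex

namespace Env

variable {K : Type u} {𝔄 : Type u} [Field K] [CharZero K] [Ring 𝔄] [Algebra K 𝔄] {E : Env K 𝔄}
  {A₁ A₂ : 𝔄}

variable (E) in
/-- `B` is the biaxiality of the pair `(A₁, A₂)`, and `g` conjugates `(A₁ B⁻¹, A₂ B⁻¹)` to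
normal form. -/
structure IsNormalizer (A₁ A₂ : 𝔄) (B g : 𝔄ˣ) : Prop where
  biax_eq : (B : 𝔄) = biax K A₁ A₂
  cong_one : E.Cong g 1
  isNormal : E.IsNormal (g * (A₁ * (B⁻¹ : 𝔄ˣ)) * (g⁻¹ : 𝔄ˣ)) (g * (A₂ * (B⁻¹ : 𝔄ˣ)) * (g⁻¹ : 𝔄ˣ))

theorem IsPert.exists_isNormalizer (hA : E.IsPert A₁ A₂) : ∃ B g, E.IsNormalizer A₁ A₂ B g := by
  obtain ⟨B, g, hB, hg, -, -, -, h⟩ := exists_normalizer (R := ⊤) (E := E) (by simp) (by simp) hA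
    ⟨_, by simp, (E.one_add_fst_mul A₁).symm⟩ ⟨_, by simp, (E.one_add_snd_mul A₂).symm⟩
  exact ⟨B, g, hB, hg, h⟩

theorem IsNormalizer.isPert (hA : E.IsPert A₁ A₂) {B g : 𝔄ˣ} (h : E.IsNormalizer A₁ A₂ B g) :
    E.IsPert (g * (A₁ * (B⁻¹ : 𝔄ˣ)) * (g⁻¹ : 𝔄ˣ)) (g * (A₂ * (B⁻¹ : 𝔄ˣ)) * (g⁻¹ : 𝔄ˣ)) :=
  (hA.mul_biax_inv h.biax_eq).conj h.cong_one

/-- The two conjugating units differ by a factor m that commutes with the base. Hence m conjugates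
word values to word values and commutes with Q_{[s]}, and it cancels. -/
theorem IsNormalizer.pull_word_eq (hA : E.IsPert A₁ A₂) {B g B' g' : 𝔄ˣ}
    (h : E.IsNormalizer A₁ A₂ B g) (h' : E.IsNormalizer A₁ A₂ B' g') (s : Comp)
    (v : List MixedIndex) :
    (g⁻¹ : 𝔄ˣ) * E.word (g * (A₁ * (B⁻¹ : 𝔄ˣ)) * (g⁻¹ : 𝔄ˣ)) (g * (A₂ * (B⁻¹ : 𝔄ˣ)) * (g⁻¹ : 𝔄ˣ)) v
        * E.Qc s * g * B
      = (g'⁻¹ : 𝔄ˣ) * E.word (g' * (A₁ * (B'⁻¹ : 𝔄ˣ)) * (g'⁻¹ : 𝔄ˣ))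
        (g' * (A₂ * (B'⁻¹ : 𝔄ˣ)) * (g'⁻¹ : 𝔄ˣ)) v * E.Qc s * g' * B' := by
  obtain rfl : B = B' := Units.ext (h.biax_eq.trans h'.biax_eq.symm)
  obtain ⟨m, rfl⟩ : ∃ m : 𝔄ˣ, g' = m * g := ⟨g' * g⁻¹, by simp⟩
  have hm : E.Cong m 1 := by
    have := h'.cong_one.mul h.cong_one.units_inv
    simpa using this
  have hN := h'.isNormal
  have e : ∀ X : 𝔄, ((m * g : 𝔄ˣ) : 𝔄) * X * ((m * g)⁻¹ : 𝔄ˣ)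
      = m * (g * X * (g⁻¹ : 𝔄ˣ)) * (m⁻¹ : 𝔄ˣ) := fun X => by
    simp [mul_assoc]
  rw [e, e] at hN ⊢
  obtain ⟨h1, h2⟩ := (h.isPert hA).commute_of_isNormal h.isNormal hm hN
  rw [word_conj h1 h2]
  have hs := (commute_Qc h1 h2 s).units_inv_left.eq
  generalize E.word _ _ v = x
  generalize E.Qc s = q at *
  simp only [mul_inv_rev, Units.val_mul, mul_assoc, Units.inv_mul_cancel_left]
  rw [← mul_assoc ((m⁻¹ : 𝔄ˣ) : 𝔄) q, hs, mul_assoc, Units.inv_mul_cancel_left]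

/-- Elements of the algebra generated by the components are combinations of words. -/
theorem exists_eq_val (hA : E.IsPert A₁ A₂) {x : 𝔄}
    (hx : x ∈ Algebra.adjoin K (Set.range (E.r A₁ A₂))) : ∃ p, x = E.val A₁ A₂ p := by
  classical
  obtain ⟨N, hN⟩ := E.nilpotent
  rw [← Subalgebra.mem_toSubmodule, Algebra.adjoin_eq_span] at hx
  induction hx using Submodule.span_induction with
  | mem x hx =>
    obtain ⟨w, rfl⟩ : ∃ w, x = E.word A₁ A₂ w := by
      induction hx using Submonoid.closure_induction with
      | mem x hx => obtain ⟨i, rfl⟩ := hx; exact ⟨[i], by simp [word]⟩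
      | one => exact ⟨[], by simp [word]⟩
      | mul x y _ _ hx hy =>
        obtain ⟨v, rfl⟩ := hx
        obtain ⟨w, rfl⟩ := hy
        exact ⟨v ++ w, by simp [word]⟩
    refine ⟨Pi.single w 1, ?_⟩
    rw [val, finsum_eq_single _ w fun v hv => by simp [Pi.single_eq_of_ne hv]]
    simp
  | zero => exact ⟨0, by simp [val]⟩
  | add x y _ _ hx hy =>
    obtain ⟨p, rfl⟩ := hx
    obtain ⟨q, rfl⟩ := hy
    refine ⟨p + q, ?_⟩
    simp [hA.val_eq_sum hN, add_smul, Finset.sum_add_distrib]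
  | smul c x _ hx =>
    obtain ⟨p, rfl⟩ := hx
    refine ⟨c • p, ?_⟩
    simp [hA.val_eq_sum hN, mul_smul, Finset.smul_sum]

theorem map_val {𝔅 : Type u} [Ring 𝔅] [Algebra K 𝔅] {E' : Env K 𝔅} (φ : 𝔄 →ₐ[K] 𝔅)
    (h₁ : φ E.Q₁ = E'.Q₁) (h₂ : φ E.Q₂ = E'.Q₂) (hA : E.IsPert A₁ A₂)
    (hA' : E'.IsPert (φ A₁) (φ A₂)) (p : List MixedIndex → K) :
    φ (E.val A₁ A₂ p) = E'.val (φ A₁) (φ A₂) p := by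
  obtain ⟨N, hN⟩ := E.nilpotent
  obtain ⟨N', hN'⟩ := E'.nilpotent
  rw [hA.val_eq_sum (pow_eq_bot_of_le hN (le_max_left N N')),
    hA'.val_eq_sum (pow_eq_bot_of_le hN' (le_max_right N N')), map_sum]
  exact Finset.sum_congr rfl fun w _ => by rw [map_smul, map_word E' φ h₁ h₂]

/-- The algebra R generated by the components is stable under conjugation by Q₁ and Q₂, so the
normalizing data can be taken in R, and gB stays in R when Q_{[s]} is moved past it. -/
theorem exists_isNormalizer_pull_word_eq_val (hA : E.IsPert A₁ A₂) :
    ∃ B g, E.IsNormalizer A₁ A₂ B g ∧ ∀ s v, ∃ p,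
      (g⁻¹ : 𝔄ˣ) * E.word (g * (A₁ * (B⁻¹ : 𝔄ˣ)) * (g⁻¹ : 𝔄ˣ)) (g * (A₂ * (B⁻¹ : 𝔄ˣ)) * (g⁻¹ : 𝔄ˣ)) v
        * E.Qc s * g * B = E.val A₁ A₂ p * E.Qc s := by
  obtain ⟨R, hR⟩ : ∃ R, R = Algebra.adjoin K (Set.range (E.r A₁ A₂)) := ⟨_, rfl⟩
  have hr : ∀ i, E.r A₁ A₂ i ∈ R := fun i => hR ▸ Algebra.subset_adjoin ⟨i, rfl⟩
  have hR₁ : ∀ x ∈ R, E.σ₁ x ∈ R := by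
    suffices R ≤ R.comap E.σ₁ from this
    conv_lhs => rw [hR]
    refine Algebra.adjoin_le ?_
    rintro _ ⟨i, rfl⟩
    simp only [Subalgebra.coe_comap, Set.mem_preimage, SetLike.mem_coe, r_eq_mix, σ₁_mix]
    exact zsmul_mem (by simpa only [r_eq_mix] using hr _) _
  have hR₂ : ∀ x ∈ R, E.σ₂ x ∈ R := by
    suffices R ≤ R.comap E.σ₂ from this
    conv_lhs => rw [hR]
    refine Algebra.adjoin_le ?_
    rintro _ ⟨i, rfl⟩
    simp only [Subalgebra.coe_comap, Set.mem_preimage, SetLike.mem_coe, r_eq_mix, σ₂_mix]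
    exact zsmul_mem (by simpa only [r_eq_mix] using hr _) _
  simp only [r_eq_mix] at hr
  have ha : E.fst A₁ ∈ R := by
    rw [E.fst_eq_sum_mix (E.fst A₁) (E.snd A₂)]
    repeat' first | apply hr | apply add_mem
  have hb : E.snd A₂ ∈ R := by
    rw [E.snd_eq_sum_mix (E.fst A₁) (E.snd A₂)]
    repeat' first | apply hr | apply sub_mem | apply add_mem | apply neg_mem
  have h₁ : ∃ ρ ∈ R, A₁ = ρ * E.Q₁ := ⟨_, add_mem (one_mem _) ha, (E.one_add_fst_mul A₁).symm⟩
  have h₂ : ∃ ρ ∈ R, A₂ = ρ * E.Q₂ := ⟨_, add_mem (one_mem _) hb, (E.one_add_snd_mul A₂).symm⟩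
  obtain ⟨B, g, hB, hg, hBR, hgR, hBiR, h⟩ := exists_normalizer hR₁ hR₂ hA h₁ h₂
  have hgiR := inv_mem hg hgR
  refine ⟨B, g, ⟨hB, hg, h⟩, fun s v => ?_⟩
  have h₁' : E.fst (g * (A₁ * (B⁻¹ : 𝔄ˣ)) * (g⁻¹ : 𝔄ˣ)) ∈ R := by
    obtain ⟨ρ, hρ, e⟩ := exists_conj_eq E.Q₁_mul hR₁
      (exists_conj_eq E.Q₁_mul hR₁ h₁ (one_mem R) hBiR) hgR hgiR
    rw [one_mul] at e
    rw [e, fst, mul_assoc, E.sq₁]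
    simpa using sub_mem hρ (one_mem R)
  have h₂' : E.snd (g * (A₂ * (B⁻¹ : 𝔄ˣ)) * (g⁻¹ : 𝔄ˣ)) ∈ R := by
    obtain ⟨ρ, hρ, e⟩ := exists_conj_eq E.Q₂_mul hR₂
      (exists_conj_eq E.Q₂_mul hR₂ h₂ (one_mem R) hBiR) hgR hgiR
    rw [one_mul] at e
    rw [e, snd, mul_assoc, E.sq₂]
    simpa using sub_mem hρ (one_mem R)
  have hw : E.word (g * (A₁ * (B⁻¹ : 𝔄ˣ)) * (g⁻¹ : 𝔄ˣ)) (g * (A₂ * (B⁻¹ : 𝔄ˣ)) * (g⁻¹ : 𝔄ˣ)) v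
      ∈ R := by
    refine list_prod_mem fun x hx => ?_
    obtain ⟨i, -, rfl⟩ := List.mem_map.mp hx
    rw [r_eq_mix]
    exact E.mix_mem (M := Subalgebra.toSubmodule R) hR₁ hR₂ h₁' h₂' i
  have hQ : ∀ y ∈ R, ∃ y' ∈ R, E.Qc s * y = y' * E.Qc s := fun y hy => by
    cases s
    · exact ⟨y, hy, by simp [Qc]⟩
    · exact ⟨_, hR₁ y hy, E.Q₁_mul y⟩
    · exact ⟨_, hR₂ y hy, E.Q₂_mul y⟩
    · exact ⟨_, hR₁ _ (hR₂ y hy), J_mul y⟩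
  obtain ⟨y, hy, hyQ⟩ := hQ _ (mul_mem hgR hBR)
  obtain ⟨p, hp⟩ := exists_eq_val hA (hR ▸ mul_mem (mul_mem hgiR hw) hy)
  refine ⟨p, ?_⟩
  rw [← hp, mul_assoc _ (g : 𝔄), mul_assoc _ (E.Qc s), hyQ]
  simp only [mul_assoc]

end Env

/-! ### Universal expansion coefficients and the reduction scheme -/

section Expansion

variable (K : Type u) [Field K] [CharZero K]

open Env

/-- An expansion in the universal environment maps to every other one. The image of a normalizer is
a normalizer, and by `pull_word_eq` the choice of normalizer does not matter. -/
theorem exists_expansion_of_nilpotent (N : ℕ) : ∃ e : Comp → List MixedIndex → List MixedIndex → K,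
    ∀ (𝔄 : Type u) [Ring 𝔄] [Algebra K 𝔄] (E : Env K 𝔄) (A₁ A₂ : 𝔄), E.IsPert A₁ A₂ →
      E.I ^ N = ⊥ → ∀ B g, E.IsNormalizer A₁ A₂ B g → ∀ s v,
      (g⁻¹ : 𝔄ˣ) * E.word (g * (A₁ * (B⁻¹ : 𝔄ˣ)) * (g⁻¹ : 𝔄ˣ)) (g * (A₂ * (B⁻¹ : 𝔄ˣ)) * (g⁻¹ : 𝔄ˣ)) v
        * E.Qc s * g * B = E.val A₁ A₂ (e s v) * E.Qc s := by
  have hU := Uni.isPert K N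
  obtain ⟨B₀, g₀, h₀, he⟩ := exists_isNormalizer_pull_word_eq_val hU
  choose e he using he
  refine ⟨e, fun 𝔄 _ _ E A₁ A₂ hA hN B g h s v => ?_⟩
  set φ := Uni.lift hA hN with hφ
  have hQ₁ : φ (Uni.env K N).Q₁ = E.Q₁ := by simp [hφ, Uni.env]
  have hQ₂ : φ (Uni.env K N).Q₂ = E.Q₂ := by simp [hφ, Uni.env]
  have hA₁ : φ (Uni.A₁ K N) = A₁ := by simp [hφ, Uni.A₁]
  have hA₂ : φ (Uni.A₂ K N) = A₂ := by simp [hφ, Uni.A₂]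
  have h' : E.IsNormalizer A₁ A₂ (Units.map (φ : Uni K N →* 𝔄) B₀)
      (Units.map (φ : Uni K N →* 𝔄) g₀) := by
    refine ⟨?_, ?_, fun i hi => ?_⟩
    · have := hU.map_biax φ
      rw [hA₁, hA₂] at this
      rw [← this, ← h₀.biax_eq]
      rfl
    · have := h₀.cong_one 𝔄 E A₁ A₂ hA hN
      simpa [Cong] using this
    · have := congrArg φ (h₀.isNormal i hi)
      rw [map_r _ E φ hQ₁ hQ₂] at this
      simpa [hA₁, hA₂, ← map_inv] using this
  rw [h.pull_word_eq hA h']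
  have := congrArg φ (he s v)
  have hA' : E.IsPert (φ (Uni.A₁ K N)) (φ (Uni.A₂ K N)) := by rwa [hA₁, hA₂]
  rw [map_mul φ (val _ _ _ _), map_val φ hQ₁ hQ₂ hU hA', map_Qc E φ hQ₁ hQ₂, hA₁, hA₂] at this
  rw [← this]
  simp only [map_mul, map_Qc E φ hQ₁ hQ₂, map_word E φ hQ₁ hQ₂, hA₁, hA₂]
  rfl

theorem exists_expansion : ∃ e : Comp → List MixedIndex → List MixedIndex → K,
    ∀ (𝔄 : Type u) [Ring 𝔄] [Algebra K 𝔄] (E : Env K 𝔄) (A₁ A₂ : 𝔄), E.IsPert A₁ A₂ →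
      ∀ B g, E.IsNormalizer A₁ A₂ B g → ∀ s v,
      (g⁻¹ : 𝔄ˣ) * E.word (g * (A₁ * (B⁻¹ : 𝔄ˣ)) * (g⁻¹ : 𝔄ˣ)) (g * (A₂ * (B⁻¹ : 𝔄ˣ)) * (g⁻¹ : 𝔄ˣ)) v
        * E.Qc s * g * B = E.val A₁ A₂ (e s v) * E.Qc s := by
  choose e he using exists_expansion_of_nilpotent K
  -- The order `w.length + 1` is the smallest in which w can be nonzero. The separating environment
  -- of that order shows that larger orders give w the same coefficient.
  refine ⟨fun s v w => e (w.length + 1) s v w, fun 𝔄 _ _ E A₁ A₂ hA B g h s v => ?_⟩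
  obtain ⟨N, hN⟩ := E.nilpotent
  rw [he N 𝔄 E A₁ A₂ hA hN B g h s v, hA.val_eq_sum hN, hA.val_eq_sum hN]
  congr 1
  refine Finset.sum_congr rfl fun w hw => ?_
  rw [mem_wordsLT] at hw
  congr 1
  obtain ⟨𝔅, _, _, E', X₁, X₂, hX, hnil, -, hsep⟩ :=
    exists_separating_env K Set.univ (by simp) w.length
  obtain ⟨B', g', h'⟩ := hX.exists_isNormalizer
  have h1 := he _ 𝔅 E' X₁ X₂ hX hnil B' g' h' s v
  have h2 := he _ 𝔅 E' X₁ X₂ hX (pow_eq_bot_of_le hnil hw) B' g' h' s v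
  exact hsep _ _ ((E'.isUnit_Qc s).mul_left_injective (h2.symm.trans h1)) w
    (fun i _ => Set.mem_univ i) le_rfl

/-- The coefficient of the word `w` in the expansion of the word `v` in the components of the
normal form, transformed back. -/
def expCoeff : Comp → List MixedIndex → List MixedIndex → K := (exists_expansion K).choose

variable {K}

theorem Env.IsNormalizer.pull_word_eq_val {𝔄 : Type u} [Ring 𝔄] [Algebra K 𝔄] {E : Env K 𝔄}
    {A₁ A₂ : 𝔄} (hA : E.IsPert A₁ A₂) {B g : 𝔄ˣ} (h : E.IsNormalizer A₁ A₂ B g) (s : Comp)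
    (v : List MixedIndex) :
    (g⁻¹ : 𝔄ˣ) * E.word (g * (A₁ * (B⁻¹ : 𝔄ˣ)) * (g⁻¹ : 𝔄ˣ)) (g * (A₂ * (B⁻¹ : 𝔄ˣ)) * (g⁻¹ : 𝔄ˣ)) v
        * E.Qc s * g * B = E.val A₁ A₂ (expCoeff K s v) * E.Qc s :=
  (exists_expansion K).choose_spec 𝔄 E A₁ A₂ hA B g h s v

/-- In the separating environment for words up to the length of w, every longer word vanishes. -/
theorem expCoeff_eq_zero (s : Comp) {v w : List MixedIndex} (h : w.length < v.length) :
    expCoeff K s v w = 0 := by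
  obtain ⟨𝔄, _, _, E, A₁, A₂, hA, hnil, -, hsep⟩ :=
    exists_separating_env K Set.univ (by simp) w.length
  obtain ⟨B, g, hg⟩ := hA.exists_isNormalizer
  have h1 := hg.pull_word_eq_val hA s v
  rw [(hg.isPert hA).word_eq_zero hnil h, mul_zero, zero_mul, zero_mul, zero_mul,
    eq_comm, (E.isUnit_Qc s).mul_left_eq_zero] at h1
  exact hsep _ 0 (h1.trans (by simp [val])) w (fun i _ => Set.mem_univ i) le_rfl

theorem Env.IsPert.isNormalizer_one {𝔄 : Type u} [Ring 𝔄] [Algebra K 𝔄] {E : Env K 𝔄}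
    {A₁ A₂ : 𝔄} (hA : E.IsPert A₁ A₂) (h : E.IsNormal A₁ A₂) :
    E.IsNormalizer A₁ A₂ 1 1 := by
  obtain ⟨hL, hR⟩ := hA.isBaseAxial_of_isNormal h
  refine ⟨?_, Cong.refl _, by simpa using h⟩
  rw [hA.biax_eq_one (hL.trans hR.symm), Units.val_one]

-- On a generic pair already in normal form, ℬ = 1 and no conjugation is needed, so each word
-- expands to itself.
open Classical in
theorem expCoeff_of_mem_words (s : Comp) {v w : List MixedIndex}
    (hw : w ∈ words {.i3, .i4, .i5}) : expCoeff K s v w = if v = w then 1 else 0 := by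
  obtain ⟨𝔄, _, _, E, A₁, A₂, hA, hnil, hr, hsep⟩ :=
    exists_separating_env K {.i3, .i4, .i5} (fun i => by cases i <;> simp [swap]) w.length
  have h1 := (hA.isNormalizer_one hr).pull_word_eq_val hA s v
  simp only [inv_one, Units.val_one, mul_one, one_mul] at h1
  have h2 : E.word A₁ A₂ v = E.val A₁ A₂ (Pi.single v 1) := by
    rw [val, finsum_eq_single _ v fun u hu => by simp [Pi.single_eq_of_ne hu]]
    simp
  rw [h2] at h1
  rw [← hsep _ _ ((E.isUnit_Qc s).mul_left_injective h1) w hw le_rfl, Pi.single_apply]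
  simp [eq_comm]

open Classical in
/-- The reduction of the lower indices to `3, 4, 5`. -/
def reduction (s : Comp) (w : List MixedIndex) : List MixedIndex →₀ K :=
  Finsupp.onFinset (wordsLT (w.length + 1))
    (fun v => if v ∈ words {.i3, .i4, .i5} then expCoeff K s v w else 0) fun v hv => by
      rw [mem_wordsLT, Nat.lt_succ_iff]
      by_contra h
      exact hv (by simp [expCoeff_eq_zero s (not_le.mp h)])

open Classical in
theorem reduction_apply (s : Comp) (v w : List MixedIndex) :
    reduction (K := K) s w v = if v ∈ words {.i3, .i4, .i5} then expCoeff K s v w else 0 := rfl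

theorem mem_support_reduction {s : Comp} {v w : List MixedIndex}
    (h : v ∈ (reduction (K := K) s w).support) :
    v ∈ words {.i3, .i4, .i5} ∧ v.length ≤ w.length := by
  rw [Finsupp.mem_support_iff, reduction_apply] at h
  refine ⟨by_contra fun hv => h (if_neg hv), by_contra fun hv => h ?_⟩
  rw [expCoeff_eq_zero s (not_le.mp hv), ite_self]

theorem isReduction_reduction : IsReduction {.i3, .i4, .i5} (reduction (K := K)) := by
  classical
  refine ⟨fun s w v hv => mem_support_reduction hv, fun s w hw => ?_⟩
  ext v
  rw [reduction_apply, Finsupp.single_apply]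
  split_ifs with h1 h2 h2
  · rw [expCoeff_of_mem_words s hw, if_pos h2.symm]
  · rw [expCoeff_of_mem_words s hw, if_neg (Ne.symm h2)]
  · exact absurd (h2 ▸ hw) h1
  · rfl

/-- Linear extension of the expansion of words. Words with a letter outside 3, 4, 5 vanish on the
normal form, which is why `reduction` may drop them. -/
theorem Env.IsNormalizer.pull_val_eq_val {𝔄 : Type u} [Ring 𝔄] [Algebra K 𝔄] {E : Env K 𝔄}
    {A₁ A₂ : 𝔄} (hA : E.IsPert A₁ A₂) {B g : 𝔄ˣ} (h : E.IsNormalizer A₁ A₂ B g) (s : Comp)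
    (p : List MixedIndex → K) :
    (g⁻¹ : 𝔄ˣ) * (E.val (g * (A₁ * (B⁻¹ : 𝔄ˣ)) * (g⁻¹ : 𝔄ˣ))
        (g * (A₂ * (B⁻¹ : 𝔄ˣ)) * (g⁻¹ : 𝔄ˣ)) p * E.Qc s) * g * B
      = E.val A₁ A₂ (fun w => (reduction s w).sum fun v a => a * p v) * E.Qc s := by
  classical
  obtain ⟨N, hN⟩ := E.nilpotent
  have hsum : ∀ w ∈ wordsLT N, ((reduction s w).sum fun v a => a * p v)
      = ∑ v ∈ wordsLT N, reduction s w v * p v := fun w hw => by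
    refine Finsupp.sum_of_support_subset _ (fun v hv => ?_) _ (by simp)
    rw [mem_wordsLT] at hw ⊢
    exact (mem_support_reduction hv).2.trans_lt hw
  have hval : E.val A₁ A₂ (fun w => (reduction s w).sum fun v a => a * p v)
      = ∑ v ∈ wordsLT N, ∑ w ∈ wordsLT N, (reduction s w v * p v) • E.word A₁ A₂ w := by
    rw [hA.val_eq_sum hN, Finset.sum_comm]
    exact Finset.sum_congr rfl fun w hw => by rw [hsum w hw, Finset.sum_smul]
  rw [(h.isPert hA).val_eq_sum hN, hval]
  simp only [Finset.sum_mul, Finset.mul_sum]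
  refine Finset.sum_congr rfl fun v _ => ?_
  rw [← Finset.sum_mul]
  by_cases hv : v ∈ words {.i3, .i4, .i5}
  · have := h.pull_word_eq_val hA s v
    rw [hA.val_eq_sum hN] at this
    simp only [reduction_apply, if_pos hv, mul_comm _ (p v), mul_smul, ← Finset.smul_sum,
      smul_mul_assoc, mul_smul_comm]
    rw [← this]
    simp only [mul_assoc]
  · simp [reduction_apply, hv, word_eq_zero_of_notMem h.isNormal hv]

end Expansion

/-! ### Axial extensions and conjugation-invariance of operations -/

open MixedIndex Env

namespace Operation

variable {K : Type u} [Field K] [CharZero K] {τ : Kind}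

omit [CharZero K] in
theorem eval_eq (Ξ : Operation K τ) {𝔄 : Type u} [Ring 𝔄] [Algebra K 𝔄] (E : Env K 𝔄)
    (A₁ A₂ : 𝔄) (s : τ.comps) : Ξ.eval E A₁ A₂ s = E.val A₁ A₂ (Ξ.coeff s) * E.Qc s := rfl

section Obeys

variable {Ξ : Operation K τ} (hΞ : Ξ.Obeys Set.univ reduction)

include hΞ

theorem Obeys.eval_eq {𝔄 : Type u} [Ring 𝔄] [Algebra K 𝔄] {E : Env K 𝔄} {A₁ A₂ : 𝔄}
    (hA : E.IsPert A₁ A₂) {B g : 𝔄ˣ} (h : E.IsNormalizer A₁ A₂ B g) (s : τ.comps) :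
    Ξ.eval E A₁ A₂ s = (g⁻¹ : 𝔄ˣ) * Ξ.eval E (g * (A₁ * (B⁻¹ : 𝔄ˣ)) * (g⁻¹ : 𝔄ˣ))
      (g * (A₂ * (B⁻¹ : 𝔄ˣ)) * (g⁻¹ : 𝔄ˣ)) s * g * B := by
  rw [Operation.eval_eq, Operation.eval_eq, h.pull_val_eq_val hA]
  congr 2
  ext1 w
  exact hΞ s w fun i _ => Set.mem_univ i

theorem Obeys.isConjInvariant : Ξ.IsConjInvariant := by
  intro 𝔄 _ _ E A₁ A₂ k hA hk _ _ s
  have hA' := hA.conj (g := k) hk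
  obtain ⟨B', g, h⟩ := hA'.exists_isNormalizer
  -- If g normalizes the conjugated pair, then gk normalizes the original one, with biaxiality B,
  -- and both reach the same normal form.
  obtain ⟨B, rfl⟩ : ∃ B, B' = k * B * k⁻¹ := ⟨k⁻¹ * B' * k, by group⟩
  have e : ∀ X : 𝔄, g * (k * X * (k⁻¹ : 𝔄ˣ) * ((k * B * k⁻¹)⁻¹ : 𝔄ˣ)) * (g⁻¹ : 𝔄ˣ)
      = (g * k : 𝔄ˣ) * (X * (B⁻¹ : 𝔄ˣ)) * ((g * k)⁻¹ : 𝔄ˣ) := fun X => by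
    simp [mul_assoc]
  have hN : E.IsNormalizer A₁ A₂ B (g * k) := by
    refine ⟨?_, ?_, ?_⟩
    · have h1 := h.biax_eq
      have h2 := hA.map_biax (conj K k)
      simp only [conj_apply] at h2
      rw [← h2, Units.val_mul, Units.val_mul] at h1
      exact k.isUnit.mul_left_cancel ((k⁻¹).isUnit.mul_right_cancel h1)
    · have hk' : E.Cong k 1 := hk
      simpa using h.cong_one.mul hk'
    · have := h.isNormal
      rwa [e, e] at this
  rw [hΞ.eval_eq hA hN, hΞ.eval_eq hA' h, e, e]
  simp [mul_assoc]

theorem Obeys.isAxialExtension : Ξ.IsAxialExtension := by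
  -- Ξ extends itself: dividing by ℬ leaves the normal form unchanged and makes the biaxiality 1.
  refine ⟨Ξ, fun 𝔄 _ _ E A₁ A₂ g hA hg _ _ s =>
    hΞ.isConjInvariant 𝔄 E A₁ A₂ g hA hg trivial trivial s, fun 𝔄 _ _ E A₁ A₂ hA s => ?_⟩
  obtain ⟨B, g, h⟩ := hA.exists_isNormalizer
  have hA' := hA.mul_biax_inv h.biax_eq
  have h' : E.IsNormalizer (A₁ * (B⁻¹ : 𝔄ˣ)) (A₂ * (B⁻¹ : 𝔄ˣ)) 1 g := by
    refine ⟨?_, h.cong_one, by simpa using h.isNormal⟩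
    rw [hA'.biax_eq_one (hA.isMonoaxial_mul_biax_inv h.biax_eq), Units.val_one]
  rw [← h.biax_eq, Ring.inverse_unit, hΞ.eval_eq hA h, hΞ.eval_eq hA' h']
  simp

end Obeys

theorem IsAxialExtension.obeys {Ξ : Operation K τ} (h : Ξ.IsAxialExtension) :
    Ξ.Obeys Set.univ reduction := by
  obtain ⟨Ψ, hΨ, hΞ⟩ := h
  -- Monoaxial invariance carries Ψ to the normal form; pulling back and comparing in a separating
  -- environment gives the rule with Ψ on the right. Ψ and Ξ agree on words in 3, 4, 5, where the
  -- rule is trivial.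
  have key : ∀ s w, Ξ.coeff s w = (reduction s.1 w).sum fun v a => a * Ψ.coeff s v := by
    intro s w
    obtain ⟨𝔄, _, _, E, A₁, A₂, hA, -, -, hsep⟩ :=
      exists_separating_env K Set.univ (by simp) w.length
    obtain ⟨B, g, h⟩ := hA.exists_isNormalizer
    have h1 := hΞ 𝔄 E A₁ A₂ hA s
    rw [← h.biax_eq, Ring.inverse_unit] at h1
    obtain ⟨hL, hR⟩ := (h.isPert hA).isBaseAxial_of_isNormal h.isNormal
    have h2 := hΨ 𝔄 E _ _ g (hA.mul_biax_inv h.biax_eq) h.cong_one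
      (hA.isMonoaxial_mul_biax_inv h.biax_eq) (hL.trans hR.symm) s
    have h3 := h.pull_val_eq_val hA s (Ψ.coeff s)
    rw [← Operation.eval_eq, h2] at h3
    rw [← mul_assoc, ← mul_assoc, Units.inv_mul, one_mul, Units.inv_mul_cancel_right, ← h1,
      Operation.eval_eq] at h3
    exact hsep _ _ ((E.isUnit_Qc s).mul_left_injective h3) w (fun i _ => Set.mem_univ i) le_rfl
  have key' : ∀ (s : τ.comps), ∀ v ∈ words {.i3, .i4, .i5}, Ξ.coeff s v = Ψ.coeff s v :=
    fun s v hv => by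
      rw [key, isReduction_reduction.2 s.1 v hv, Finsupp.sum_single_index] <;> simp
  intro s w _
  rw [key]
  exact Finsupp.sum_congr fun v hv => by rw [key' s v (mem_support_reduction hv).1]

theorem isAxialExtension_iff_obeys (Ξ : Operation K τ) :
    Ξ.IsAxialExtension ↔ Ξ.Obeys Set.univ reduction :=
  ⟨IsAxialExtension.obeys, Obeys.isAxialExtension⟩

/-- The operation that obeys the reduction and has the same coefficients as `Ξ` on the words
with letters `3, 4, 5`. -/
def reduce (Ξ : Operation K τ) : Operation K τ where
  coeff s w := (reduction s.1 w).sum fun v a => a * Ξ.coeff s v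

theorem reduce_coeff (Ξ : Operation K τ) (s : τ.comps) {w : List MixedIndex}
    (hw : w ∈ words {.i3, .i4, .i5}) : Ξ.reduce.coeff s w = Ξ.coeff s w := by
  change (reduction (K := K) s.1 w).sum (fun v a => a * Ξ.coeff s v) = _
  rw [isReduction_reduction.2 s.1 w hw, Finsupp.sum_single_index] <;> simp

theorem obeys_reduce (Ξ : Operation K τ) : Ξ.reduce.Obeys Set.univ reduction := by
  intro s w _
  change (reduction (K := K) s.1 w).sum (fun v a => a * Ξ.coeff s v) = _
  exact Finsupp.sum_congr fun v hv => by rw [reduce_coeff Ξ s (mem_support_reduction hv).1]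

omit [CharZero K] in
theorem eval_eq_of_conj {Ξ Ξ' : Operation K τ}
    {P : ∀ {𝔄 : Type u} [Ring 𝔄] [Algebra K 𝔄], Env K 𝔄 → 𝔄 → 𝔄 → Prop}
    (h : Ξ.IsConjInvariantOn P) (h' : Ξ'.IsConjInvariantOn P) {T : Set MixedIndex}
    (hT : ∀ s, ∀ w ∈ words T, Ξ.coeff s w = Ξ'.coeff s w)
    {𝔄 : Type u} [Ring 𝔄] [Algebra K 𝔄] {E : Env K 𝔄} {A₁ A₂ : 𝔄} (hA : E.IsPert A₁ A₂) {g : 𝔄ˣ}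
    (hg : E.Cong g 1) (h₁ : P E A₁ A₂) (h₂ : P E (g * A₁ * (g⁻¹ : 𝔄ˣ)) (g * A₂ * (g⁻¹ : 𝔄ˣ)))
    (hr : ∀ i ∉ T, E.r (g * A₁ * (g⁻¹ : 𝔄ˣ)) (g * A₂ * (g⁻¹ : 𝔄ˣ)) i = 0) (s : τ.comps) :
    Ξ.eval E A₁ A₂ s = Ξ'.eval E A₁ A₂ s := by
  have e1 := h 𝔄 E A₁ A₂ g hA hg h₁ h₂ s
  have e2 := h' 𝔄 E A₁ A₂ g hA hg h₁ h₂ s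
  rw [eval_eq, val_congr hr (hT s), ← eval_eq Ξ', e2] at e1
  exact (g.isUnit.mul_left_cancel ((g⁻¹).isUnit.mul_right_cancel e1)).symm

theorem coeff_eq_of_eval_eq {Ξ Ξ' : Operation K τ} {T : Set MixedIndex}
    (hT : ∀ i, swap i ∈ T ↔ i ∈ T)
    (h : ∀ (𝔄 : Type u) [Ring 𝔄] [Algebra K 𝔄] (E : Env K 𝔄) (A₁ A₂ : 𝔄), E.IsPert A₁ A₂ →
      (∀ i ∉ T, E.r A₁ A₂ i = 0) → ∀ s, Ξ.eval E A₁ A₂ s = Ξ'.eval E A₁ A₂ s)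
    (s : τ.comps) {w : List MixedIndex} (hw : w ∈ words T) : Ξ.coeff s w = Ξ'.coeff s w := by
  obtain ⟨𝔄, _, _, E, A₁, A₂, hA, -, hr, hsep⟩ := exists_separating_env K T hT w.length
  exact hsep _ _ ((E.isUnit_Qc s).mul_left_injective (h 𝔄 E A₁ A₂ hA hr s)) w hw le_rfl

theorem isAxialExtension_of_reduce_coeff {Ξ : Operation K τ}
    (h : ∀ s w, Ξ.coeff s w = Ξ.reduce.coeff s w) : Ξ.IsAxialExtension :=
  Obeys.isAxialExtension fun s w _ => h s w

/-- The pairs with axis J are those with only the components 3, 4, 5, 6, and they reach normal form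
by conjugation within the class. There Ξ and `reduce Ξ` have the same relevant coefficients. -/
theorem coeff_eq_reduce_coeff_of_isBaseAxial {Ξ : Operation K τ}
    (h : Ξ.IsConjInvariantOn Env.IsBaseAxial) (s : τ.comps) {w : List MixedIndex}
    (hw : w ∈ words {.i3, .i4, .i5, .i6}) : Ξ.coeff s w = Ξ.reduce.coeff s w := by
  refine coeff_eq_of_eval_eq (fun i => by cases i <;> simp [swap])
    (fun 𝔄 _ _ E A₁ A₂ hA hr s => ?_) s hw
  have hax : E.IsBaseAxial A₁ A₂ := hA.isBaseAxial_iff.mpr ((E.anticommute_J_iff A₁ A₂).mpr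
    ⟨hr _ (by simp), hr _ (by simp), hr _ (by simp), hr _ (by simp)⟩)
  obtain ⟨g, hg, -, -, hN⟩ := exists_normalizer_of_isBaseAxial (R := ⊤) (by simp) hA hax
    ⟨_, by simp, (E.one_add_fst_mul A₁).symm⟩ ⟨_, by simp, (E.one_add_snd_mul A₂).symm⟩
  exact eval_eq_of_conj (P := Env.IsBaseAxial) h (fun 𝔄 _ _ E A₁ A₂ g hA hg _ _ s =>
      Ξ.obeys_reduce.isConjInvariant 𝔄 E A₁ A₂ g hA hg trivial trivial s)
    (fun s w hw => (Ξ.reduce_coeff s hw).symm) hA hg hax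
    ((hA.conj hg).isBaseAxial_of_isNormal hN) hN s

/-- Every pair is conjugate to one without the components 6, 7, 8, where the assumed rules already
identify Ξ with `reduce Ξ`. -/
theorem coeff_eq_reduce_coeff_of_isConjInvariant {Ξ : Operation K τ} (h : Ξ.IsConjInvariant)
    (hd : Ξ.Obeys {.i1, .i2, .i3, .i4, .i5} reduction) (s : τ.comps) (w : List MixedIndex) :
    Ξ.coeff s w = Ξ.reduce.coeff s w := by
  refine coeff_eq_of_eval_eq (T := Set.univ) (by simp) (fun 𝔄 _ _ E A₁ A₂ hA _ s => ?_) s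
    fun i _ => Set.mem_univ i
  obtain ⟨g, hg, hr⟩ := hA.exists_conj_r_eq_zero
  exact eval_eq_of_conj h Ξ.obeys_reduce.isConjInvariant (T := {.i1, .i2, .i3, .i4, .i5})
    (fun s w hw => hd s w hw) hA hg trivial trivial
    (fun i hi => hr i (by cases i <;> simp at hi ⊢)) s

end Operation

end FQ

end

theorem mainTheorem2 {K : Type u} [Field K] [CharZero K] :
    (∃ c : FQ.Comp → List FQ.MixedIndex → (List FQ.MixedIndex →₀ K),
      FQ.IsReduction {.i3, .i4, .i5, .i6} c ∧
      ∀ (τ : FQ.Kind) (Ξ : FQ.Operation K τ),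
        Ξ.IsAxialExtension ↔
          Ξ.IsConjInvariantOn FQ.Env.IsBaseAxial ∧ Ξ.Obeys Set.univ c) ∧
    (∃ d : FQ.Comp → List FQ.MixedIndex → (List FQ.MixedIndex →₀ K),
      FQ.IsReduction {.i3, .i4, .i5} d ∧
      ∀ (τ : FQ.Kind) (Ξ : FQ.Operation K τ),
        (Ξ.IsAxialExtension ↔
          Ξ.IsConjInvariant ∧ Ξ.Obeys {.i1, .i2, .i3, .i4, .i5} d) ∧
        (Ξ.IsAxialExtension ↔ Ξ.Obeys Set.univ d)) := by
  classical
  -- The scheme c is trivial on words in 3, 4, 5, 6, as it must be, and equals `reduction`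
  -- elsewhere. The rules it omits are recovered from invariance on pairs with axis J.
  refine ⟨⟨fun s w => if w ∈ FQ.words {.i3, .i4, .i5, .i6} then Finsupp.single w 1
    else FQ.reduction s w, ⟨fun s w v hv => ?_, fun s w hw => if_pos hw⟩, fun τ Ξ => ⟨?_, ?_⟩⟩,
    FQ.reduction, FQ.isReduction_reduction, fun τ Ξ => ⟨⟨?_, ?_⟩, Ξ.isAxialExtension_iff_obeys⟩⟩
  · dsimp only at hv
    split_ifs at hv with hw
    · obtain rfl : v = w := by simpa using Finsupp.support_single_subset hv
      exact ⟨hw, le_rfl⟩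
    · obtain ⟨h1, h2⟩ := FQ.mem_support_reduction hv
      exact ⟨fun i hi => by have := h1 i hi; simp at this ⊢; tauto, h2⟩
  · intro h
    refine ⟨fun 𝔄 _ _ E A₁ A₂ g hA hg _ _ s =>
      h.obeys.isConjInvariant 𝔄 E A₁ A₂ g hA hg trivial trivial s, fun s w hw => ?_⟩
    dsimp only
    split_ifs with hw'
    · rw [Finsupp.sum_single_index] <;> simp
    · exact h.obeys s w hw
  · rintro ⟨h1, h2⟩
    refine FQ.Operation.isAxialExtension_of_reduce_coeff fun s w => ?_
    by_cases hw : w ∈ FQ.words {.i3, .i4, .i5, .i6}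
    · exact FQ.Operation.coeff_eq_reduce_coeff_of_isBaseAxial h1 s hw
    · have := h2 s w fun i _ => Set.mem_univ i
      dsimp only at this
      rwa [if_neg hw] at this
  · intro h
    exact ⟨h.obeys.isConjInvariant, fun s w _ => h.obeys s w fun i _ => Set.mem_univ i⟩
  · rintro ⟨h1, h2⟩
    exact FQ.Operation.isAxialExtension_of_reduce_coeff
      (FQ.Operation.coeff_eq_reduce_coeff_of_isConjInvariant h1 h2)
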